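/- **Setting (knapsack with Bursty Adversary plus Random Order).** Let $n\in\mathbb N$ be the number of time steps and $k$ the (real) knapsack size, with $80\le k\le n/2$; let the window size $\ell\in\mathbb N$ be $\frac{n\ln k}{k}$ up to rounding, i.e. $|\ell-\frac{n\ln k}{k}|<1$; and let $\Gamma\in\mathbb N$ with $\Gamma\ge\sqrt k$. The times $[n]=\{1,\dots,n\}$ are partitioned into the consecutive windows $\{1,\dots,\ell\},\{\ell+1,\dots,2\ell\},\dots$ (the last one possibly truncated). The adversary fixes a set $Adv\subseteq[n]$, a family of at most $\Gamma$ windows (the adversarial windows) covering $Adv$, and, with $RO=[n]\setminus Adv$, items $(v_i,w_i)$, $i=1,\dots,|RO|$, with $v_i>0$, $w_i\in(0,1]$ and pairwise different densities $v_i/w_i$. A uniformly random bijection $t\mapsto I_t$ from $RO$ to $\{1,\dots,|RO|\}$ is drawn. At a time $t\in RO$ the item with value $V_t=v_{I_t}$ and size $W_t=w_{I_t}$ arrives; at a time $t\in Adv$ an arbitrary item with $V_t\ge0$, $W_t\in[0,1]$ arrives, which may depend on the algorithm and on the whole bijection. A time is *free* if it lies in no adversarial window (so it is in $RO$). **Algorithm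 with parameter $a_4$.** At time $t$ the algorithm takes an arbitrary optimal solution $X^t$ of the linear program: maximize $\sum_{s\le t}V_sX_s$ over $X\in[0,1]^t$ subject to $\sum_{s\le t}W_sX_s\le\big(1-\frac{4\Gamma\ell}{t}\big)\frac tn k$ and $\sum_{s\in B\cap[t]}W_sX_s\le 601\,\frac{\ell}{n}k$ for every window $B$ (if the program is infeasible, $X^t$ is arbitrary). The item of time $t$ is tentatively picked if $X^t_t>0$. Let $F_t=1$ if $$\sum_{s\in B_t,\ s<t}W_sX^{alg}_s\le a_4\frac{\ell}{n}k-1\qquad\text{and}\qquad\sum_{s<t}W_sX^{alg}_s\le k-1,$$ where $B_t$ is the window containing $t$; otherwise $F_t=0$, and the algorithm is *blocked* at time $t$. The algorithm sets $X^{alg}_t=1$ if the item of time $t$ is tentatively picked and $F_t=1$, and $X^{alg}_t=0$ otherwise. **Theorem (probability of being blocked).** For every sufficiently large constant $a_4$ there are constants $a_5,C>0$, depending only on $a_4$, such that in every instance as above, for every free time $t\ge 8\ell(\Gamma+2)$ with $1-\frac tn-a_5\frac{\Gamma\ln k}{k}>0$ and every item index $i\in\{1,\dots,|RO|\}$, $$\Pr\big(F_t=0\mid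 I_t=i\big)\le\frac{C}{k\left(1-\frac tn-a_5\frac{\Gamma\ln k}{k}\right)^2}.$$ -/

import Mathlib

/-- The `b`-th window (`b = 0, 1, 2, …`) of length `ℓ`: the times `bℓ + 1, …, (b + 1)ℓ`.
Times are numbered from `1`. -/
def baroWindow (ℓ b : ℕ) : Finset ℕ := Finset.Icc (b * ℓ + 1) ((b + 1) * ℓ)

/-- The last window `{⌊s/ℓ⌋ℓ + 1, …, s}`, with `s = t - 1`, of the windows truncated to `[t - 1]`.
It consists of the times before `t` in the window of `t`, and is empty if `t` opens a window. -/
def baroLast (ℓ t : ℕ) : Finset ℕ := Finset.Icc ((t - 1) / ℓ * ℓ + 1) (t - 1)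

/-- What the adversary fixes in advance in the BARO knapsack model. -/
structure BaroInstance where
  /-- number of time steps -/
  n : ℕ
  /-- knapsack size -/
  k : ℝ
  /-- window size, `n ln k / k` up to rounding -/
  ℓ : ℕ
  /-- bound on the number of adversarial windows -/
  Γ : ℕ
  /-- adversarial times -/
  adv : Finset ℕ
  /-- (indices of) the windows that cover the adversarial times -/
  advWindows : Finset ℕ
  /-- values of the random-order items -/
  v : Fin (Finset.Icc 1 n \ adv).card → ℝ
  /-- sizes of the random-order items -/
  w : Fin (Finset.Icc 1 n \ adv).card → ℝ
  k_ge : 80 ≤ k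
  k_le : k ≤ (n : ℝ) / 2
  ℓ_eq : |(ℓ : ℝ) - n * Real.log k / k| < 1
  Γ_ge : Real.sqrt k ≤ Γ
  adv_subset : adv ⊆ Finset.Icc 1 n
  advWindows_card : advWindows.card ≤ Γ
  adv_covered : ∀ t ∈ adv, ∃ b ∈ advWindows, t ∈ baroWindow ℓ b
  v_pos : ∀ i, 0 < v i
  w_pos : ∀ i, 0 < w i
  w_le_one : ∀ i, w i ≤ 1
  /-- no ties among the value densities -/
  density_injective : Function.Injective fun i => v i / w i

namespace BaroInstance

/-- The random-order times. -/
abbrev ro (M : BaroInstance) : Finset ℕ := Finset.Icc 1 M.n \ M.adv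

/-- A time is free if it lies in none of the adversarial windows. -/
def IsFree (M : BaroInstance) (t : ℕ) : Prop :=
  t ∈ Finset.Icc 1 M.n ∧ ∀ b ∈ M.advWindows, t ∉ baroWindow M.ℓ b

theorem IsFree.mem_ro {M : BaroInstance} {t : ℕ} (h : M.IsFree t) : t ∈ M.ro := by
  refine Finset.mem_sdiff.2 ⟨h.1, fun ha => ?_⟩
  obtain ⟨b, hb, htb⟩ := M.adv_covered t ha
  exact h.2 b hb htb

/-- The budget scaling `c_t = 1 - 4Γℓ/t`. -/
noncomputable def scale (M : BaroInstance) (t : ℕ) : ℝ := 1 - 4 * M.Γ * M.ℓ / t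

/-- Feasibility for the linear program of time `t`, for the item sizes `W`. Only the coordinates
`x 1, …, x t` matter. The windows truncated to `[t]` are indexed by all `b`; those that are empty
give trivial constraints. -/
def LPFeasible (M : BaroInstance) (W : ℕ → ℝ) (t : ℕ) (x : ℕ → ℝ) : Prop :=
  ∑ s ∈ Finset.Icc 1 t, W s * x s ≤ M.scale t * (t / M.n) * M.k ∧
  (∀ b, ∑ s ∈ baroWindow M.ℓ b ∩ Finset.Icc 1 t, W s * x s ≤ 601 * (M.ℓ / M.n) * M.k) ∧
  ∀ s ∈ Finset.Icc 1 t, 0 ≤ x s ∧ x s ≤ 1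

/-- Optimality for the linear program of time `t`, for the item values `V` and sizes `W`. -/
def LPOptimal (M : BaroInstance) (V W : ℕ → ℝ) (t : ℕ) (x : ℕ → ℝ) : Prop :=
  M.LPFeasible W t x ∧ ∀ y, M.LPFeasible W t y →
    ∑ s ∈ Finset.Icc 1 t, V s * y s ≤ ∑ s ∈ Finset.Icc 1 t, V s * x s

/-- The outer constraint and the main budget, which the earlier selections `x 1, …, x (t - 1)` have
to satisfy in order that the item of time `t` may be picked. -/
def Unblocked (M : BaroInstance) (a₄ : ℝ) (W : ℕ → ℝ) (x : ℕ → ℝ) (t : ℕ) : Prop :=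
  ∑ s ∈ baroLast M.ℓ t, W s * x s ≤ a₄ * (M.ℓ / M.n) * M.k - 1 ∧
  ∑ s ∈ Finset.Ico 1 t, W s * x s ≤ M.k - 1

open Classical in
/-- The selections of the algorithm up to time `t` (and `0` for later times), given the item sizes
`W` and the solutions `X t` of the linear programs. -/
noncomputable def selUpTo (M : BaroInstance) (a₄ : ℝ) (W : ℕ → ℝ) (X : ℕ → ℕ → ℝ) : ℕ → ℕ → ℝ
  | 0 => 0
  | t + 1 => Function.update (selUpTo M a₄ W X t) (t + 1)
      (if 0 < X (t + 1) (t + 1) ∧ M.Unblocked a₄ W (selUpTo M a₄ W X t) (t + 1) then 1 else 0)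

/-- The selection of the algorithm at time `t`. -/
noncomputable def xalg (M : BaroInstance) (a₄ : ℝ) (W : ℕ → ℝ) (X : ℕ → ℕ → ℝ) (t : ℕ) : ℝ :=
  M.selUpTo a₄ W X t t

theorem selUpTo_eq_xalg (M : BaroInstance) (a₄ : ℝ) (W : ℕ → ℝ) (X : ℕ → ℕ → ℝ) {s t : ℕ}
    (h : s ≤ t) : M.selUpTo a₄ W X t s = M.xalg a₄ W X s := by
  induction t with
  | zero => rw [Nat.le_zero.1 h]; rfl
  | succ t ih =>
    rcases Nat.lt_or_ge t s with h' | h'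
    · rw [show s = t + 1 by omega]; rfl
    · rw [← ih h', selUpTo, Function.update_of_ne (by omega)]

open Classical in
/-- The item of time `t` is picked exactly if it is tentatively picked and not blocked. -/
theorem xalg_eq (M : BaroInstance) (a₄ : ℝ) (W : ℕ → ℝ) (X : ℕ → ℕ → ℝ) {t : ℕ} (ht : 1 ≤ t) :
    M.xalg a₄ W X t =
      if 0 < X t t ∧ M.Unblocked a₄ W (M.xalg a₄ W X) t then 1 else 0 := by
  obtain ⟨t, rfl⟩ : ∃ u, t = u + 1 := ⟨t - 1, by omega⟩
  have key : M.Unblocked a₄ W (M.selUpTo a₄ W X t) (t + 1) ↔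
      M.Unblocked a₄ W (M.xalg a₄ W X) (t + 1) := by
    unfold Unblocked
    rw [Finset.sum_congr rfl (fun s hs => by
        rw [selUpTo_eq_xalg M a₄ W X (by simp [baroLast] at hs; omega)]),
      Finset.sum_congr (s₁ := Finset.Ico 1 (t + 1)) rfl (fun s hs => by
        rw [selUpTo_eq_xalg M a₄ W X (by simp at hs; omega)])]
  rw [xalg, selUpTo, Function.update_self, key]

end BaroInstance

/-- A random run of the BARO model together with the solutions of the linear programs that the
algorithm uses. The items at the adversarial times are arbitrary random variables: they may depend
on the whole order of the random-order items, on the behaviour of the algorithm and on further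
randomness. -/
structure BaroRun (M : BaroInstance) {Ω : Type*} [MeasurableSpace Ω]
    (P : MeasureTheory.Measure Ω) where
  /-- the random-order items in their random order: `I ω t` is the item that appears at time `t` -/
  I : Ω → (M.ro ≃ Fin M.ro.card)
  /-- `V ω t` is the value of the item of time `t` -/
  V : Ω → ℕ → ℝ
  /-- `W ω t` is the size of the item of time `t` -/
  W : Ω → ℕ → ℝ
  /-- `X ω t` is the solution of the linear program of time `t` that the algorithm finds -/
  X : Ω → ℕ → ℕ → ℝ
  I_measurable : ∀ σ, MeasurableSet {ω | I ω = σ}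
  I_uniform : ∀ σ, P.real {ω | I ω = σ} = 1 / (M.ro.card.factorial : ℝ)
  V_measurable : ∀ t, Measurable fun ω => V ω t
  W_measurable : ∀ t, Measurable fun ω => W ω t
  X_measurable : ∀ t s, Measurable fun ω => X ω t s
  V_nonneg : ∀ ω, ∀ t ∈ Finset.Icc 1 M.n, 0 ≤ V ω t
  W_mem : ∀ ω, ∀ t ∈ Finset.Icc 1 M.n, W ω t ∈ Set.Icc (0 : ℝ) 1
  V_ro : ∀ ω (t : M.ro), V ω t = M.v (I ω t)
  W_ro : ∀ ω (t : M.ro), W ω t = M.w (I ω t)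
  /-- The algorithm may use any optimal solution. For `t < 4Γℓ` the program is infeasible, and
  nothing is required of `X ω t`, so that every convention for these times is allowed. -/
  X_optimal : ∀ ω, ∀ t ∈ Finset.Icc 1 M.n, (∃ x, M.LPFeasible (W ω) t x) →
    M.LPOptimal (V ω) (W ω) t (X ω t)

/-- The event `F_t = 0`: the algorithm is blocked at time `t`. -/
def BaroRun.blocked {M : BaroInstance} {Ω : Type*} [MeasurableSpace Ω]
    {P : MeasureTheory.Measure Ω} (S : BaroRun M P) (a₄ : ℝ) (t : ℕ) : Set Ω :=
  {ω | ¬ M.Unblocked a₄ (S.W ω) (M.xalg a₄ (S.W ω) (S.X ω)) t}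

/-! Let D be the set of densest random-order items, of total size between k and k + 1 (or all
items). The k + 1 allows for the last item added.

At a late free time s, the dense items seen in earlier free windows have expected size about (b −
Γ)·share, where b counts the complete windows before s and share = ℓk/n ≈ ln k. The LP budget is at
most (b + 1 − 4Γ)·share, so the dense items exceed it by a margin of order Γ ln k. Because Γ ≥ √k,
this margin is a factor ln k above the fluctuations, which are of order √k. If moreover no window is
overfull with dense items, an exchange argument (`LPOptimal.nonpos_of_dense`) shows that an LP
optimum never uses a non-dense item at such a time. Adversarial items cannot interfere, since the
exchanges take place inside free windows or with the item of time s itself. So in a typical order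
the load picked at late free times is dominated by the load of D (`dense_of_picked`).

The remaining times lie in at most 5Γ windows: the first 4Γ and the adversarial ones. There the
outer constraint caps the load at a₄·share per window. Hence blocking at t requires an atypical
order, or a dense load before t exceeding its mean by about kδ, with δ the bracket in the bound
(`unblocked_of_typical`).

Conditioned on the item at t, the order is uniform over the bijections with one value fixed.
Sampling without replacement then has exponential moments no larger than independent sampling, which
gives Chernoff bounds (`card_pinnedEquivs_tail_le`). Atypical orders cost 2/k², summed over at most
k windows; the excess load costs exp(−kδ²/8). -/

/-! ### Tail bounds for sampling without replacement -/

section Sampling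

variable {α β : Type*} [Fintype α] [Fintype β] [DecidableEq α] [DecidableEq β]

/-- The bijections that send `a` to `i`. -/
def pinnedEquivs (a : α) (i : β) : Finset (α ≃ β) := {σ | σ a = i}

/-- The bijections that send `a` to `i` and place all items of `S` into `T`. -/
def placingEquivs (a : α) (i : β) (T : Finset α) (S : Finset β) : Finset (α ≃ β) :=
  {σ ∈ pinnedEquivs a i | ∀ j ∈ S, σ.symm j ∈ T}

/-- Transposing j and j' after σ is injective and disturbs neither i nor S. Used in both directions,
this makes the count independent of the inserted item. -/
theorem card_placingEquivs_insert_swap {a : α} {i : β} {T : Finset α} {S : Finset β} {j j' : β}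
    (hj : j ∉ S) (hj' : j' ∉ S) (hi : j ≠ i) (hi' : j' ≠ i) :
    (placingEquivs a i T (insert j S)).card ≤ (placingEquivs a i T (insert j' S)).card := by
  refine Finset.card_le_card_of_injOn (fun σ => σ.trans (Equiv.swap j j')) ?_ ?_
  · intro σ hσ
    simp only [placingEquivs, pinnedEquivs, Finset.coe_filter, Finset.mem_filter,
      Finset.mem_univ, true_and, Set.mem_ofPred_eq, Finset.forall_mem_insert,
      Equiv.trans_apply, Equiv.symm_trans_apply, Equiv.symm_swap, Equiv.swap_apply_right] at hσ ⊢
    refine ⟨?_, hσ.2.1, fun r hr => ?_⟩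
    · rw [hσ.1, Equiv.swap_apply_of_ne_of_ne hi.symm hi'.symm]
    · rw [Equiv.swap_apply_of_ne_of_ne (ne_of_mem_of_not_mem hr hj) (ne_of_mem_of_not_mem hr hj')]
      exact hσ.2.2 r hr
  · intro σ _ τ _ h
    ext x
    have := congrArg (fun e : α ≃ β => e x) h
    simpa using this

/-- Double counting of pairs (σ, r) with r outside S ∪ {i} placed in T. By symmetry every r
contributes equally. Each σ admits |T| − |S| choices, because S already lies in T while i sits at a
∉ T. -/
theorem card_placingEquivs_insert {a : α} {i : β} {T : Finset α} (ha : a ∉ T) {S : Finset β}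
    {j : β} (hj : j ∉ S) (hi : i ∉ S) (hji : j ≠ i) :
    ((Fintype.card β : ℝ) - 1 - S.card) * (placingEquivs a i T (insert j S)).card =
      (T.card - S.card) * (placingEquivs a i T S).card := by
  set R : Finset β := Finset.univ \ insert i S with hR
  have hRc : (R.card : ℝ) = (Fintype.card β : ℝ) - 1 - S.card := by
    rw [hR, Finset.cast_card_sdiff (Finset.subset_univ _), Finset.card_insert_of_notMem hi,
      Finset.card_univ]
    push_cast; ring
  have hsum : ∑ r ∈ R, ((placingEquivs a i T (insert r S)).card : ℝ) =
      (Fintype.card β - 1 - S.card) * (placingEquivs a i T (insert j S)).card := by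
    rw [← hRc, ← nsmul_eq_mul]
    refine Finset.sum_eq_card_nsmul fun r hr => ?_
    simp only [hR, Finset.mem_sdiff, Finset.mem_univ, true_and, Finset.mem_insert, not_or] at hr
    exact congrArg Nat.cast (le_antisymm (card_placingEquivs_insert_swap hr.2 hj hr.1 hji)
      (card_placingEquivs_insert_swap hj hr.2 hji hr.1))
  rw [← hsum]
  have hcount : ∀ σ ∈ placingEquivs a i T S,
      (({r ∈ R | σ.symm r ∈ T}).card : ℝ) = T.card - S.card := by
    intro σ hσ
    simp only [placingEquivs, pinnedEquivs, Finset.mem_filter, Finset.mem_univ, true_and] at hσ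
    have hsub : S ⊆ T.map σ.toEmbedding := by
      intro r hr
      exact Finset.mem_map.2 ⟨_, hσ.2 r hr, by simp⟩
    have : ({r ∈ R | σ.symm r ∈ T} : Finset β) = T.map σ.toEmbedding \ S := by
      ext r
      simp only [hR, Finset.mem_filter, Finset.mem_sdiff, Finset.mem_univ, true_and,
        Finset.mem_insert, not_or, Finset.mem_map_equiv]
      constructor
      · rintro ⟨⟨-, h⟩, h'⟩; exact ⟨h', h⟩
      · rintro ⟨h', h⟩
        refine ⟨⟨?_, h⟩, h'⟩
        rintro rfl
        rw [← hσ.1, Equiv.symm_apply_apply] at h'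
        exact ha h'
    rw [this, Finset.cast_card_sdiff hsub, Finset.card_map]
  have hexp : ∀ r, ((placingEquivs a i T (insert r S)).card : ℝ) =
      ∑ σ ∈ placingEquivs a i T S, if σ.symm r ∈ T then (1 : ℝ) else 0 := by
    intro r
    rw [Finset.sum_boole]
    congr 2
    ext σ
    simp only [placingEquivs, Finset.mem_filter, Finset.forall_mem_insert]
    tauto
  simp_rw [hexp]
  rw [Finset.sum_comm]
  simp_rw [Finset.sum_boole]
  rw [Finset.sum_congr rfl hcount, Finset.sum_const, nsmul_eq_mul, mul_comm]

/-- The probability that the items of `S` all land in `T` is at most what it would be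
for independent placements. -/
theorem card_placingEquivs_le {a : α} {i : β} {T : Finset α} (ha : a ∉ T) (S : Finset β) :
    ((placingEquivs a i T S).card : ℝ) ≤
      ((T.card : ℝ) / (Fintype.card α - 1)) ^ S.card * (pinnedEquivs a i).card := by
  by_cases hne : Nonempty (α ≃ β)
  swap
  · have h0 : (placingEquivs a i T S).card = 0 :=
      Finset.card_eq_zero.2 (Finset.eq_empty_of_forall_notMem fun σ _ => hne ⟨σ⟩)
    have h1 : (pinnedEquivs a i).card = 0 :=
      Finset.card_eq_zero.2 (Finset.eq_empty_of_forall_notMem fun σ _ => hne ⟨σ⟩)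
    simp [h0, h1]
  have hcard : Fintype.card α = Fintype.card β := Fintype.card_congr hne.some
  have hT : (T.card : ℝ) ≤ Fintype.card α - 1 := by
    have := Finset.card_le_univ (insert a T)
    rw [Finset.card_insert_of_notMem ha] at this
    have : ((T.card + 1 : ℕ) : ℝ) ≤ Fintype.card α := by exact_mod_cast this
    push_cast at this; linarith
  have hp0 : (0 : ℝ) ≤ (T.card : ℝ) / (Fintype.card α - 1) :=
    div_nonneg (Nat.cast_nonneg _) (le_trans (Nat.cast_nonneg _) hT)
  by_cases hiS : i ∈ S
  · have : placingEquivs a i T S = ∅ := by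
      refine Finset.eq_empty_of_forall_notMem fun σ hσ => ?_
      simp only [placingEquivs, pinnedEquivs, Finset.mem_filter, Finset.mem_univ, true_and] at hσ
      have := hσ.2 i hiS
      rw [← hσ.1, Equiv.symm_apply_apply] at this
      exact ha this
    rw [this]
    simp only [Finset.card_empty, Nat.cast_zero]
    positivity
  induction S using Finset.induction_on with
  | empty => simp [placingEquivs]
  | insert j S hj ih =>
    rw [Finset.mem_insert, not_or] at hiS
    have h1 := card_placingEquivs_insert ha hj hiS.2 (Ne.symm hiS.1)
    have ih := ih hiS.2
    have hpos : (0 : ℝ) < Fintype.card β - 1 - S.card := by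
      have := Finset.card_le_univ (insert i (insert j S))
      rw [Finset.card_insert_of_notMem (by simp [hiS]), Finset.card_insert_of_notMem hj] at this
      have : ((S.card + 1 + 1 : ℕ) : ℝ) ≤ Fintype.card β := by exact_mod_cast this
      push_cast at this; linarith
    have hm : (0 : ℝ) < Fintype.card α - 1 := by
      rw [hcard]
      have : (0 : ℝ) ≤ S.card := Nat.cast_nonneg _
      linarith
    have hN : (0 : ℝ) ≤ (placingEquivs a i T S).card := Nat.cast_nonneg _
    have hstep : ((placingEquivs a i T (insert j S)).card : ℝ) ≤
        (T.card : ℝ) / (Fintype.card α - 1) * (placingEquivs a i T S).card := by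
      rw [div_mul_eq_mul_div, le_div_iff₀ hm]
      refine le_of_mul_le_mul_left ?_ hpos
      rw [← mul_assoc, h1]
      rw [hcard] at hT hm ⊢
      -- Removing |S| from numerator and denominator only lowers the ratio |T|/(m − 1), which is at
      -- most 1.
      have : ((T.card : ℝ) - S.card) * (Fintype.card β - 1) ≤
          (Fintype.card β - 1 - S.card) * T.card := by
        nlinarith [(Nat.cast_nonneg S.card : (0 : ℝ) ≤ S.card)]
      nlinarith [mul_le_mul_of_nonneg_right this hN]
    rw [Finset.card_insert_of_notMem hj, pow_succ', mul_assoc]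
    exact hstep.trans (mul_le_mul_of_nonneg_left ih hp0)

/-- Exponential moments of a sampled sum. -/
theorem sum_exp_pinnedEquivs_le {a : α} {i : β} {T : Finset α} (ha : a ∉ T) {y : β → ℝ}
    (hy0 : ∀ j, 0 ≤ y j) (hy1 : ∀ j, y j ≤ 1) {θ : ℝ} (hθ0 : 0 ≤ θ) (hθ1 : θ ≤ 1) :
    ∑ σ ∈ pinnedEquivs a i, Real.exp (θ * ∑ u ∈ T, y (σ u)) ≤
      Real.exp ((T.card : ℝ) / (Fintype.card α - 1) * (∑ j, y j) * (θ + θ ^ 2)) *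
        (pinnedEquivs a i).card := by
  set p : ℝ := (T.card : ℝ) / (Fintype.card α - 1) with hp
  have hp0 : 0 ≤ p := by
    refine div_nonneg (Nat.cast_nonneg _) (sub_nonneg.2 ?_)
    exact_mod_cast Fintype.card_pos_iff.2 ⟨a⟩
  -- Since z ≥ 0, the exponential expands into placement indicators with nonnegative coefficients,
  -- so the bound for each S can be applied term by term.
  set z : β → ℝ := fun j => Real.exp (θ * y j) - 1 with hz
  have hz0 : ∀ j, 0 ≤ z j := fun j => sub_nonneg.2 (Real.one_le_exp (mul_nonneg hθ0 (hy0 j)))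
  have hz1 : ∀ j, z j ≤ y j * (θ + θ ^ 2) := by
    intro j
    have h0 : 0 ≤ θ * y j := mul_nonneg hθ0 (hy0 j)
    have h1 : θ * y j ≤ 1 := by nlinarith [hy0 j, hy1 j]
    have h := (abs_le.1 (Real.abs_exp_sub_one_sub_id_le (x := θ * y j)
      (by rwa [abs_of_nonneg h0]))).2
    have h2 : (y j) ^ 2 ≤ y j := by nlinarith [hy0 j, hy1 j]
    have h3 : θ ^ 2 * (y j) ^ 2 ≤ θ ^ 2 * y j := mul_le_mul_of_nonneg_left h2 (sq_nonneg θ)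
    simp only [hz]
    nlinarith
  have hexpand : ∀ σ ∈ pinnedEquivs a i, Real.exp (θ * ∑ u ∈ T, y (σ u)) =
      ∑ S ∈ (Finset.univ : Finset β).powerset,
        (∏ j ∈ S, z j) * if ∀ j ∈ S, σ.symm j ∈ T then 1 else 0 := by
    intro σ _
    calc Real.exp (θ * ∑ u ∈ T, y (σ u)) = ∏ u ∈ T, (z (σ u) + 1) := by
          rw [Finset.mul_sum, Real.exp_sum]
          exact Finset.prod_congr rfl fun u _ => by simp [hz]
      _ = ∏ j, ((z j * if σ.symm j ∈ T then 1 else 0) + 1) := by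
          rw [← Equiv.prod_comp σ, ← Finset.prod_subset (Finset.subset_univ T)]
          · exact Finset.prod_congr rfl fun u hu => by simp [hu]
          · intro u _ hu
            simp [hu]
      _ = _ := by
          rw [Finset.prod_add_one]
          refine Finset.sum_congr rfl fun S _ => ?_
          rw [Finset.prod_mul_distrib, Finset.prod_ite_zero]
          simp
  rw [Finset.sum_congr rfl hexpand, Finset.sum_comm]
  have hinner : ∀ S ∈ (Finset.univ : Finset β).powerset,
      (∑ σ ∈ pinnedEquivs a i,
        (∏ j ∈ S, z j) * if ∀ j ∈ S, σ.symm j ∈ T then (1 : ℝ) else 0) ≤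
      (∏ j ∈ S, p * z j) * (pinnedEquivs a i).card := by
    intro S _
    rw [← Finset.mul_sum, Finset.sum_boole, Finset.prod_mul_distrib, Finset.prod_const,
      mul_comm (p ^ _), mul_assoc]
    exact mul_le_mul_of_nonneg_left (card_placingEquivs_le ha S)
      (Finset.prod_nonneg fun j _ => hz0 j)
  refine (Finset.sum_le_sum hinner).trans ?_
  rw [← Finset.sum_mul, ← Finset.prod_add_one]
  refine mul_le_mul_of_nonneg_right ?_ (Nat.cast_nonneg _)
  rw [mul_assoc, Finset.sum_mul, Finset.mul_sum, Real.exp_sum]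
  refine Finset.prod_le_prod (fun j _ => add_nonneg (mul_nonneg hp0 (hz0 j)) zero_le_one)
    fun j _ => ?_
  exact (Real.add_one_le_exp _).trans
    (Real.exp_le_exp.2 (mul_le_mul_of_nonneg_left (hz1 j) hp0))

/-- A Chernoff bound for sampling without replacement, conditional on the item at `a`. -/
theorem card_pinnedEquivs_tail_le {a : α} {i : β} {T : Finset α} (ha : a ∉ T) {y : β → ℝ}
    (hy0 : ∀ j, 0 ≤ y j) (hy1 : ∀ j, y j ≤ 1) {θ : ℝ} (hθ0 : 0 ≤ θ) (hθ1 : θ ≤ 1)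
    {c d κ lam : ℝ} (hκ : (T.card : ℝ) / (Fintype.card α - 1) * ∑ j, y j ≤ κ)
    (hlam : (T.card : ℝ) / (Fintype.card α - 1) * ∑ j, y j + lam ≤ c)
    (hd : θ ^ 2 * κ - θ * lam ≤ d) :
    ((({σ ∈ pinnedEquivs a i | c ≤ ∑ u ∈ T, y (σ u)} : Finset (α ≃ β)).card : ℝ)) ≤
      Real.exp d * (pinnedEquivs a i).card := by
  set μ := (T.card : ℝ) / (Fintype.card α - 1) * ∑ j, y j with hμ
  have hmarkov : ((({σ ∈ pinnedEquivs a i | c ≤ ∑ u ∈ T, y (σ u)} : Finset (α ≃ β)).card : ℝ)) *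
      Real.exp (θ * c) ≤ Real.exp (μ * (θ + θ ^ 2)) * (pinnedEquivs a i).card := by
    refine le_trans ?_ (sum_exp_pinnedEquivs_le ha hy0 hy1 hθ0 hθ1)
    rw [← nsmul_eq_mul]
    refine (Finset.card_nsmul_le_sum _ (fun σ => Real.exp (θ * ∑ u ∈ T, y (σ u))) _
      fun σ hσ => ?_).trans
      (Finset.sum_le_sum_of_subset_of_nonneg (Finset.filter_subset _ _)
        fun _ _ _ => (Real.exp_pos _).le)
    exact Real.exp_le_exp.2 (mul_le_mul_of_nonneg_left (Finset.mem_filter.1 hσ).2 hθ0)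
  rw [← le_div_iff₀ (Real.exp_pos _), mul_div_right_comm, ← Real.exp_sub] at hmarkov
  refine hmarkov.trans (mul_le_mul_of_nonneg_right (Real.exp_le_exp.2 ?_) (Nat.cast_nonneg _))
  -- The exponent is θ²μ − θ(c − μ). Only the quadratic term uses the crude bound κ on the mean; the
  -- linear term uses the sharper gap `lam`.
  nlinarith [mul_le_mul_of_nonneg_left hlam hθ0, mul_le_mul_of_nonneg_left hκ (sq_nonneg θ)]

end Sampling

/-! ### Windows and the outer constraint -/

theorem mem_baroWindow_iff {ℓ b t : ℕ} (ht : 1 ≤ t) (hℓ : 0 < ℓ) :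
    t ∈ baroWindow ℓ b ↔ b = (t - 1) / ℓ := by
  rw [baroWindow, Finset.mem_Icc, eq_comm, Nat.div_eq_iff hℓ]
  constructor
  · rintro ⟨h1, h2⟩
    rw [add_mul, one_mul] at h2
    omega
  · rintro ⟨h1, h2⟩
    rw [add_mul, one_mul]
    omega

theorem card_baroWindow (ℓ b : ℕ) : (baroWindow ℓ b).card = ℓ := by
  rw [baroWindow, Nat.card_Icc, add_mul, one_mul]; omega

theorem baroLast_eq {ℓ t : ℕ} (ht : 1 ≤ t) (hℓ : 0 < ℓ) :
    baroLast ℓ t = baroWindow ℓ ((t - 1) / ℓ) ∩ Finset.Ico 1 t := by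
  ext s
  have h2 := Nat.lt_div_mul_add (a := t - 1) hℓ
  simp only [baroLast, baroWindow, Finset.mem_inter, Finset.mem_Icc, Finset.mem_Ico, add_mul,
    one_mul]
  omega

namespace BaroInstance

theorem xalg_nonneg (M : BaroInstance) (a₄ : ℝ) (W : ℕ → ℝ) (X : ℕ → ℕ → ℝ) {t : ℕ}
    (ht : 1 ≤ t) : 0 ≤ M.xalg a₄ W X t := by
  rw [xalg_eq M a₄ W X ht]; split_ifs <;> norm_num

/-- The outer constraint bounds the load of every window. -/
theorem sum_window_xalg_le (M : BaroInstance) {a₄ : ℝ} {W : ℕ → ℝ} (X : ℕ → ℕ → ℝ)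
    (hℓ : 0 < M.ℓ) (hq : 0 ≤ a₄ * (M.ℓ / M.n) * M.k)
    (hW : ∀ t ∈ Finset.Icc 1 M.n, W t ∈ Set.Icc (0 : ℝ) 1) (b : ℕ) {t : ℕ} (ht : t ≤ M.n) :
    ∑ s ∈ baroWindow M.ℓ b ∩ Finset.Ico 1 (t + 1), W s * M.xalg a₄ W X s ≤
      a₄ * (M.ℓ / M.n) * M.k := by
  classical
  induction t with
  | zero => simpa using hq
  | succ t ih =>
    have ih := ih (by omega)
    have ht1 : 1 ≤ t + 1 := by omega
    have hins : Finset.Ico 1 (t + 1 + 1) = insert (t + 1) (Finset.Ico 1 (t + 1)) := by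
      ext s; simp only [Finset.mem_insert, Finset.mem_Ico]; omega
    rw [hins]
    by_cases hb : t + 1 ∈ baroWindow M.ℓ b
    · rw [Finset.inter_insert_of_mem hb, Finset.sum_insert (by simp)]
      rw [xalg_eq M a₄ W X ht1]
      split_ifs with h
      · have h1 := h.2.1
        rw [baroLast_eq ht1 hℓ, ← (mem_baroWindow_iff ht1 hℓ).1 hb] at h1
        have h2 := (hW (t + 1) (Finset.mem_Icc.2 ⟨ht1, ht⟩)).2
        linarith
      · linarith
    · rwa [Finset.inter_insert_of_notMem hb]

/-! ### Optimal solutions of the linear programs -/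

/-- Moving capacity from an item to a denser one is impossible in an optimal solution. -/
theorem LPOptimal.no_exchange {M : BaroInstance} {V W : ℕ → ℝ} {s : ℕ} {x : ℕ → ℝ}
    (h : M.LPOptimal V W s x) {u r b₀ : ℕ} (hu : u ∈ Finset.Icc 1 s) (hr : r ∈ Finset.Icc 1 s)
    (hur : u ≠ r) (hWu : 0 < W u) (hWr : 0 < W r) (hd : V r / W r < V u / W u)
    (hxu : x u < 1) (hxr : 0 < x r) (hb₀ : ∀ b, u ∈ baroWindow M.ℓ b → b = b₀)
    (hslack : r ∈ baroWindow M.ℓ b₀ ∨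
      ∑ s ∈ baroWindow M.ℓ b₀ ∩ Finset.Icc 1 s, W s * x s < 601 * (M.ℓ / M.n) * M.k) : False := by
  classical
  -- Here ε is an amount of capacity: u gains ε / W u and r loses ε / W r, so the total load is
  -- unchanged.
  obtain ⟨ε, hε, hεu, hεr, hεs⟩ : ∃ ε : ℝ, 0 < ε ∧ ε ≤ W u * (1 - x u) ∧ ε ≤ W r * x r ∧
      (r ∈ baroWindow M.ℓ b₀ ∨ ∑ s ∈ baroWindow M.ℓ b₀ ∩ Finset.Icc 1 s, W s * x s + ε ≤
        601 * (M.ℓ / M.n) * M.k) := by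
    have h1 : 0 < W u * (1 - x u) := mul_pos hWu (by linarith)
    have h2 : 0 < W r * x r := mul_pos hWr hxr
    rcases hslack with h3 | h3
    · exact ⟨_, lt_min h1 h2, min_le_left _ _, min_le_right _ _, Or.inl h3⟩
    · refine ⟨_, lt_min (lt_min h1 h2) (sub_pos.2 h3), (min_le_left _ _).trans (min_le_left _ _),
        (min_le_left _ _).trans (min_le_right _ _), Or.inr ?_⟩
      linarith [min_le_right (min (W u * (1 - x u)) (W r * x r)) (601 * (M.ℓ / M.n) * M.k -
        ∑ s ∈ baroWindow M.ℓ b₀ ∩ Finset.Icc 1 s, W s * x s)]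
  set y : ℕ → ℝ := fun j =>
    x j + (if j = u then ε / W u else 0) - (if j = r then ε / W r else 0) with hy
  have hsum : ∀ (c : ℕ → ℝ) (A : Finset ℕ), ∑ j ∈ A, c j * y j = ∑ j ∈ A, c j * x j +
      (if u ∈ A then c u * (ε / W u) else 0) - (if r ∈ A then c r * (ε / W r) else 0) := by
    intro c A
    simp only [hy, mul_sub, mul_add, mul_ite, mul_zero, Finset.sum_sub_distrib,
      Finset.sum_add_distrib, Finset.sum_ite_eq']
  have hcu : W u * (ε / W u) = ε := mul_div_cancel₀ _ hWu.ne'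
  have hcr : W r * (ε / W r) = ε := mul_div_cancel₀ _ hWr.ne'
  have hfeas : M.LPFeasible W s y := by
    obtain ⟨hf1, hf2, hf3⟩ := h.1
    refine ⟨?_, fun b => ?_, fun j hj => ?_⟩
    · rw [hsum, if_pos hu, if_pos hr, hcu, hcr]
      linarith
    · rw [hsum, hcu, hcr]
      have := hf2 b
      by_cases hub : u ∈ baroWindow M.ℓ b
      · obtain rfl := hb₀ b hub
        rw [if_pos (Finset.mem_inter.2 ⟨hub, hu⟩)]
        rcases hεs with h3 | h3
        · rw [if_pos (Finset.mem_inter.2 ⟨h3, hr⟩)]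
          linarith
        · split_ifs <;> linarith
      · rw [if_neg (fun h => hub (Finset.mem_inter.1 h).1)]
        split_ifs <;> linarith
    · have hj' := hf3 j hj
      have e1 : ε / W u ≤ 1 - x u := by rwa [div_le_iff₀' hWu]
      have e2 : ε / W r ≤ x r := by rwa [div_le_iff₀' hWr]
      have e3 : 0 < ε / W u := div_pos hε hWu
      have e4 : 0 < ε / W r := div_pos hε hWr
      by_cases hju : j = u
      · subst hju
        simp only [hy, if_true, if_neg hur]
        constructor <;> linarith [hj'.1]
      · by_cases hjr : j = r
        · subst hjr
          simp only [hy, if_true, if_neg hju]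
          constructor <;> linarith [hj'.2]
        · simpa only [hy, if_neg hju, if_neg hjr, add_zero, sub_zero] using hj'
  have hopt := h.2 y hfeas
  rw [hsum, if_pos hu, if_pos hr] at hopt
  have e1 : V u * (ε / W u) = ε * (V u / W u) := by ring
  have e2 : V r * (ε / W r) = ε * (V r / W r) := by ring
  rw [e1, e2] at hopt
  nlinarith [mul_lt_mul_of_pos_left hd hε]

/-- If the items at the times `F` outweigh the budget, but saturate no window, and all other items
of their windows are less dense, then no less dense item is picked. -/
theorem LPOptimal.nonpos_of_dense {M : BaroInstance} {V W : ℕ → ℝ} {s : ℕ} {x : ℕ → ℝ}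
    (h : M.LPOptimal V W s x) (hℓ : 0 < M.ℓ) (hs : 1 ≤ s) (hWs : 0 < W s)
    (hW : ∀ u ∈ Finset.Icc 1 s, 0 ≤ W u) {F : Finset ℕ}
    (hF : F ⊆ Finset.Icc 1 s) (hsF : s ∉ F) (hWF : ∀ u ∈ F, 0 < W u)
    (hd : ∀ u ∈ F, V s / W s < V u / W u)
    (hbud : M.scale s * (s / M.n) * M.k < ∑ u ∈ F, W u)
    (hwin : ∀ u ∈ F, ∀ b, u ∈ baroWindow M.ℓ b →
      ∑ r ∈ F ∩ baroWindow M.ℓ b, W r < 601 * (M.ℓ / M.n) * M.k)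
    (hdw : ∀ u ∈ F, ∀ b, u ∈ baroWindow M.ℓ b → ∀ r ∈ baroWindow M.ℓ b ∩ Finset.Icc 1 s, r ∉ F →
      0 < W r ∧ V r / W r < V u / W u) :
    x s ≤ 0 := by
  classical
  by_contra! hxs
  have hsI : s ∈ Finset.Icc 1 s := Finset.mem_Icc.2 ⟨hs, le_rfl⟩
  obtain ⟨u, huF, hxu⟩ : ∃ u ∈ F, x u < 1 := by
    by_contra! hcon
    have h1 : ∑ u ∈ F, W u ≤ ∑ u ∈ F, W u * x u :=
      Finset.sum_le_sum fun u hu => le_mul_of_one_le_right (hWF u hu).le (hcon u hu)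
    have h2 : ∑ u ∈ F, W u * x u ≤ ∑ u ∈ Finset.Icc 1 s, W u * x u :=
      Finset.sum_le_sum_of_subset_of_nonneg hF fun u hu _ => mul_nonneg (hW u hu) (h.1.2.2 u hu).1
    linarith [h.1.1]
  have hu1 : 1 ≤ u := (Finset.mem_Icc.1 (hF huF)).1
  have hub : u ∈ baroWindow M.ℓ ((u - 1) / M.ℓ) := (mem_baroWindow_iff hu1 hℓ).2 rfl
  have huniq : ∀ b, u ∈ baroWindow M.ℓ b → b = (u - 1) / M.ℓ :=
    fun b hb => (mem_baroWindow_iff hu1 hℓ).1 hb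
  set b₀ := (u - 1) / M.ℓ
  -- If the window of u has slack, u is exchanged with s. If it is tight, F alone cannot fill it, so
  -- it contains a used item r outside F, and the exchange stays within the window.
  rcases (h.1.2.1 b₀).lt_or_eq with hlt | heq
  · exact h.no_exchange (hF huF) hsI (fun e => hsF (e ▸ huF)) (hWF u huF) hWs (hd u huF) hxu hxs
      huniq (Or.inr hlt)
  · obtain ⟨r, hr, hrF, hxr⟩ : ∃ r ∈ baroWindow M.ℓ b₀ ∩ Finset.Icc 1 s, r ∉ F ∧ 0 < x r := by
      by_contra! hcon
      have : ∑ r ∈ baroWindow M.ℓ b₀ ∩ Finset.Icc 1 s, W r * x r ≤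
          ∑ r ∈ F ∩ baroWindow M.ℓ b₀, W r := by
        have hsub : F ∩ baroWindow M.ℓ b₀ ⊆ baroWindow M.ℓ b₀ ∩ Finset.Icc 1 s := fun r hr =>
          Finset.mem_inter.2 ⟨(Finset.mem_inter.1 hr).2, hF (Finset.mem_inter.1 hr).1⟩
        rw [← Finset.sum_sdiff hsub]
        have h1 : ∑ r ∈ (baroWindow M.ℓ b₀ ∩ Finset.Icc 1 s) \ (F ∩ baroWindow M.ℓ b₀),
            W r * x r ≤ 0 := by
          refine Finset.sum_nonpos fun r hr => ?_
          obtain ⟨hr1, hr2⟩ := Finset.mem_sdiff.1 hr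
          have hrF : r ∉ F := fun hF => hr2 (Finset.mem_inter.2 ⟨hF, (Finset.mem_inter.1 hr1).1⟩)
          exact mul_nonpos_of_nonneg_of_nonpos (hW r (Finset.mem_inter.1 hr1).2) (hcon r hr1 hrF)
        have h2 : ∑ r ∈ F ∩ baroWindow M.ℓ b₀, W r * x r ≤ ∑ r ∈ F ∩ baroWindow M.ℓ b₀, W r :=
          Finset.sum_le_sum fun r hr => mul_le_of_le_one_right
            (hWF r (Finset.mem_inter.1 hr).1).le (h.1.2.2 r (hF (Finset.mem_inter.1 hr).1)).2
        linarith
      linarith [hwin u huF b₀ hub]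
    have := hdw u huF b₀ hub r hr hrF
    exact h.no_exchange (hF huF) (Finset.mem_inter.1 hr).2 (fun e => hrF (e ▸ huF)) (hWF u huF)
      this.1 this.2 hxu hxr huniq (Or.inl (Finset.mem_inter.1 hr).1)

end BaroInstance

/-- The top items of total size about `k`. -/
theorem exists_dense_finset {ι : Type*} [Fintype ι] [DecidableEq ι] {d w : ι → ℝ}
    (hd : Function.Injective d) (hw1 : ∀ i, w i ≤ 1) {k : ℝ} (hk : 0 ≤ k) :
    ∃ D : Finset ι, (∀ i ∈ D, ∀ j ∉ D, d j < d i) ∧ ∑ i ∈ D, w i ≤ k + 1 ∧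
      (D = Finset.univ ∨ k ≤ ∑ i ∈ D, w i) := by
  classical
  -- A largest density-closed set of size at most k + 1 works: below k, the densest remaining item
  -- would still fit.
  set Q : Finset (Finset ι) :=
    {D | (∀ i ∈ D, ∀ j ∉ D, d j < d i) ∧ ∑ i ∈ D, w i ≤ k + 1} with hQ
  have hne : Q.Nonempty := ⟨∅, by simp [hQ]; linarith⟩
  obtain ⟨D, hD, hmax⟩ := Finset.exists_max_image Q Finset.card hne
  rw [hQ, Finset.mem_filter] at hD
  refine ⟨D, hD.2.1, hD.2.2, ?_⟩
  by_contra! hcon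
  have hcompl : (Dᶜ).Nonempty := by
    rw [Finset.nonempty_iff_ne_empty, Ne, Finset.compl_eq_empty_iff]; exact hcon.1
  obtain ⟨j, hj, hjmax⟩ := Finset.exists_max_image Dᶜ d hcompl
  rw [Finset.mem_compl] at hj
  have hmem : insert j D ∈ Q := by
    rw [hQ, Finset.mem_filter]
    refine ⟨Finset.mem_univ _, ?_, ?_⟩
    · intro i hi r hr
      rw [Finset.mem_insert, not_or] at hr
      rcases Finset.mem_insert.1 hi with rfl | hi
      · exact lt_of_le_of_ne (hjmax r (Finset.mem_compl.2 hr.2)) (fun e => hr.1 (hd e))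
      · exact hD.2.1 i hi r hr.2
    · rw [Finset.sum_insert hj]
      linarith [hw1 j]
  have := hmax _ hmem
  rw [Finset.card_insert_of_notMem hj] at this
  omega

namespace BaroInstance

/-! ### The parameters of an instance -/

theorem n_pos (M : BaroInstance) : (0 : ℝ) < M.n := by linarith [M.k_ge, M.k_le]

theorem four_le_log (M : BaroInstance) : 4 ≤ Real.log M.k := by
  have hk := M.k_ge
  rw [Real.le_log_iff_exp_le (by linarith)]
  have h1 : Real.exp 4 = Real.exp 1 ^ 4 := by rw [← Real.exp_nat_mul]; norm_num
  have h2 : Real.exp 1 ≤ 2.72 := by linarith [Real.exp_one_lt_d9]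
  have h3 : Real.exp 1 ^ 4 ≤ 2.72 ^ 4 := pow_le_pow_left₀ (Real.exp_pos 1).le h2 4
  rw [h1]
  norm_num at h3 ⊢
  linarith

/-- The share `ℓk/n` of the budget that belongs to a window. -/
noncomputable def share (M : BaroInstance) : ℝ := M.ℓ / M.n * M.k

/-- Rounding ℓ by less than 1 changes the share by less than k/n ≤ 1/2, which is at most an eighth
of ln k ≥ 4. -/
theorem share_bounds (M : BaroInstance) :
    7 / 8 * Real.log M.k ≤ M.share ∧ M.share ≤ 9 / 8 * Real.log M.k := by
  have hn := M.n_pos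
  have hk : 0 < M.k := by linarith [M.k_ge]
  have hL := M.four_le_log
  have hq : M.share - Real.log M.k = (M.ℓ - M.n * Real.log M.k / M.k) * (M.k / M.n) := by
    rw [share]; field_simp
  have hkn : M.k / M.n ≤ 1 / 2 := by rw [div_le_iff₀ hn]; linarith [M.k_le]
  have hkn0 : 0 < M.k / M.n := div_pos hk hn
  obtain ⟨h1, h2⟩ := abs_lt.1 M.ℓ_eq
  constructor <;> nlinarith

theorem share_ge (M : BaroInstance) : 7 / 2 ≤ M.share := by
  linarith [M.share_bounds.1, M.four_le_log]

theorem ℓ_pos (M : BaroInstance) : 0 < M.ℓ := by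
  rcases Nat.eq_zero_or_pos M.ℓ with h | h
  · have := M.share_ge
    rw [share, h] at this
    norm_num at this
  · exact h

theorem sqrt_ge (M : BaroInstance) : 8 ≤ Real.sqrt M.k :=
  Real.le_sqrt_of_sq_le (by linarith [M.k_ge])

theorem Γ_ge_eight (M : BaroInstance) : (8 : ℝ) ≤ M.Γ := M.sqrt_ge.trans M.Γ_ge

/-- Makes θ = ln k/√k admissible in the Chernoff bound, which needs θ ≤ 1. -/
theorem log_le_sqrt (M : BaroInstance) : Real.log M.k ≤ Real.sqrt M.k := by
  have hs : 0 < Real.sqrt M.k := by linarith [M.sqrt_ge]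
  have h1 : Real.log M.k = 2 * Real.log (Real.sqrt M.k) := by
    rw [Real.log_sqrt (by linarith [M.k_ge])]; ring
  have h2 : Real.log (Real.sqrt M.k / 2) ≤ Real.sqrt M.k / 2 - 1 :=
    Real.log_le_sub_one_of_pos (by linarith)
  rw [Real.log_div hs.ne' two_ne_zero] at h2
  linarith [Real.log_two_lt_d9]

theorem window_count_le (M : BaroInstance) : ((M.n / M.ℓ + 1 : ℕ) : ℝ) ≤ M.k := by
  have hn := M.n_pos
  have hℓ : (0 : ℝ) < M.ℓ := by exact_mod_cast M.ℓ_pos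
  have h1 : ((M.n / M.ℓ : ℕ) : ℝ) ≤ M.n / M.ℓ := Nat.cast_div_le
  have h2 : (M.n : ℝ) / M.ℓ ≤ M.k / 2 := by
    have := M.share_ge
    rw [share, div_mul_eq_mul_div, le_div_iff₀ hn] at this
    rw [div_le_iff₀ hℓ]
    nlinarith [M.k_ge]
  push_cast
  linarith [M.k_ge]

/-- The Chernoff exponent for θ = ln k/√k. From Γ ≥ √k the gap is at least (7/4)√k ln k, so the
linear term gains (7/4)ln²k, against a quadratic term of at most (65/64)ln²k. The difference exceeds
2 ln k because ln k ≥ 4. -/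
theorem underfull_exponent_le (M : BaroInstance) :
    (Real.log M.k / Real.sqrt M.k) ^ 2 * (M.k + 1) -
      Real.log M.k / Real.sqrt M.k * ((3 * M.Γ - 1) * M.share - 1) ≤ -(2 * Real.log M.k) := by
  have h1 := M.share_bounds.1
  have h2 := M.Γ_ge
  have hΓ := M.Γ_ge_eight
  have hq := M.share_ge
  have hs := M.sqrt_ge
  have hL := M.four_le_log
  have hrk : M.k = Real.sqrt M.k ^ 2 := (Real.sq_sqrt (by linarith [M.k_ge])).symm
  set r := Real.sqrt M.k
  set L := Real.log M.k
  have hlam : 7 / 4 * r * L ≤ (3 * M.Γ - 1) * M.share - 1 := by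
    have h3 : 2 * r ≤ 2 * M.Γ := by linarith
    have h4 := mul_le_mul h3 h1 (by positivity) (by positivity)
    have h5 : 2 * M.share ≤ (M.Γ - 1) * M.share :=
      mul_le_mul_of_nonneg_right (by linarith) (by linarith)
    linarith
  have h3 : (L / r) * (7 / 4 * r * L) = 7 / 4 * L ^ 2 := by field_simp
  have h4 : (L / r) ^ 2 * (M.k + 1) = L ^ 2 + L ^ 2 / r ^ 2 := by rw [hrk]; field_simp
  have h5 : L ^ 2 / r ^ 2 ≤ L ^ 2 / 64 :=
    div_le_div_of_nonneg_left (by positivity) (by norm_num) (by nlinarith)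
  have h6 := mul_le_mul_of_nonneg_left hlam (show 0 ≤ L / r by positivity)
  have h7 : 4 * L ≤ L ^ 2 := by nlinarith
  linarith

/-- The union of the adversarial windows. -/
def advUnion (M : BaroInstance) : Finset ℕ := M.advWindows.biUnion (baroWindow M.ℓ)

theorem card_advUnion_le (M : BaroInstance) : M.advUnion.card ≤ M.Γ * M.ℓ :=
  (Finset.card_biUnion_le_card_mul _ _ _ fun b _ => (card_baroWindow M.ℓ b).le).trans
    (Nat.mul_le_mul_right _ M.advWindows_card)

theorem adv_subset_advUnion (M : BaroInstance) : M.adv ⊆ M.advUnion := fun t ht => by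
  obtain ⟨b, hb, htb⟩ := M.adv_covered t ht
  exact Finset.mem_biUnion.2 ⟨b, hb, htb⟩

theorem isFree_iff (M : BaroInstance) {t : ℕ} :
    M.IsFree t ↔ t ∈ Finset.Icc 1 M.n ∧ t ∉ M.advUnion := by
  simp [IsFree, advUnion]

theorem card_ro_le (M : BaroInstance) : (M.ro.card : ℝ) ≤ M.n := by
  have := Finset.card_le_card (Finset.sdiff_subset (s := Finset.Icc 1 M.n) (t := M.adv))
  rw [Nat.card_Icc] at this
  exact_mod_cast this.trans (by omega)

theorem card_ro_ge (M : BaroInstance) : (M.n : ℝ) - M.Γ * M.ℓ ≤ M.ro.card := by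
  have h1 : _ ≤ M.ro.card := Finset.le_card_sdiff M.adv (Finset.Icc 1 M.n)
  have h2 := (Finset.card_le_card M.adv_subset_advUnion).trans M.card_advUnion_le
  rw [Nat.card_Icc] at h1
  have h3 : M.n ≤ M.ro.card + M.Γ * M.ℓ := by omega
  have : (M.n : ℝ) ≤ M.ro.card + M.Γ * M.ℓ := by exact_mod_cast h3
  linarith

/-- If a time as late as `8ℓ(Γ + 2)` exists, then most times are random-order times. -/
theorem card_ro_sub_one_ge (M : BaroInstance) (h : 8 * M.ℓ * (M.Γ + 2) ≤ M.n) :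
    7 / 8 * (M.n : ℝ) ≤ M.ro.card - 1 := by
  have h1 : (8 * M.ℓ * (M.Γ + 2) : ℝ) ≤ M.n := by exact_mod_cast h
  have h2 : (1 : ℝ) ≤ M.ℓ := by exact_mod_cast M.ℓ_pos
  nlinarith [M.card_ro_ge]

/-! ### Loads of items -/

/-- The contribution of time `s` to a sum of item weights `y` in the order `σ`. -/
noncomputable def itemLoad (M : BaroInstance) (y : Fin M.ro.card → ℝ)
    (σ : M.ro ≃ Fin M.ro.card) (s : ℕ) : ℝ :=
  if h : s ∈ M.ro then y (σ ⟨s, h⟩) else 0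

theorem sum_itemLoad (M : BaroInstance) (y : Fin M.ro.card → ℝ) (σ : M.ro ≃ Fin M.ro.card)
    (A : Finset ℕ) :
    ∑ s ∈ A, M.itemLoad y σ s = ∑ u ∈ A.subtype (· ∈ M.ro), y (σ u) := by
  have : ∀ u : M.ro, y (σ u) = M.itemLoad y σ u := fun u => by
    rw [itemLoad, dif_pos u.2]
  simp_rw [this]
  rw [Finset.sum_subtype_eq_sum_filter, Finset.sum_filter]
  refine Finset.sum_congr rfl fun s _ => ?_
  split_ifs with h
  · rfl
  · rw [itemLoad, dif_neg h]

theorem itemLoad_nonneg (M : BaroInstance) {y : Fin M.ro.card → ℝ} (hy : ∀ j, 0 ≤ y j)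
    (σ : M.ro ≃ Fin M.ro.card) (s : ℕ) : 0 ≤ M.itemLoad y σ s := by
  rw [itemLoad]; split_ifs
  · exact hy _
  · exact le_rfl

/-! ### Tail bounds for loads in a random order -/

section Tails

variable {M : BaroInstance} {y : Fin M.ro.card → ℝ} {t : ℕ}

/-- It is unlikely that a window receives `601` times its share. -/
theorem card_window_overfull_le (ht : t ∈ M.ro) (i : Fin M.ro.card)
    (h8 : 8 * M.ℓ * (M.Γ + 2) ≤ M.n) (hy0 : ∀ j, 0 ≤ y j) (hy1 : ∀ j, y j ≤ 1)
    (hY : ∑ j, y j ≤ M.k + 1) (b : ℕ) :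
    (({σ ∈ pinnedEquivs (⟨t, ht⟩ : M.ro) i | 601 * M.share ≤
      ∑ s ∈ baroWindow M.ℓ b ∩ Finset.Ico 1 t, M.itemLoad y σ s} : Finset _).card : ℝ) ≤
      Real.exp (-(2 * Real.log M.k)) * (pinnedEquivs (⟨t, ht⟩ : M.ro) i).card := by
  simp_rw [sum_itemLoad]
  have hn := M.n_pos
  have hm := M.card_ro_sub_one_ge h8
  have hm0 : (0 : ℝ) < M.ro.card - 1 := by linarith
  have hcard : (((baroWindow M.ℓ b ∩ Finset.Ico 1 t).subtype (· ∈ M.ro)).card : ℝ) ≤ M.ℓ := by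
    rw [Finset.card_subtype]
    exact_mod_cast (Finset.card_filter_le _ _).trans
      ((Finset.card_le_card Finset.inter_subset_left).trans (card_baroWindow _ _).le)
  have hYn : 0 ≤ ∑ j, y j := Finset.sum_nonneg fun j _ => hy0 j
  have hμ : (((baroWindow M.ℓ b ∩ Finset.Ico 1 t).subtype (· ∈ M.ro)).card : ℝ) /
      (Fintype.card M.ro - 1) * ∑ j, y j ≤ 2 * M.share := by
    rw [Fintype.card_coe]
    have h1 : (((baroWindow M.ℓ b ∩ Finset.Ico 1 t).subtype (· ∈ M.ro)).card : ℝ) /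
        (M.ro.card - 1) ≤ M.ℓ / (7 / 8 * M.n) :=
      div_le_div₀ (Nat.cast_nonneg _) hcard (by positivity) hm
    have h2 : (M.ℓ : ℝ) / (7 / 8 * M.n) = 8 / 7 * (M.ℓ / M.n) := by field_simp
    have h3 : (0 : ℝ) ≤ M.ℓ / M.n := by positivity
    refine (mul_le_mul h1 hY hYn (by positivity)).trans ?_
    rw [h2, share]
    nlinarith [M.k_ge]
  -- 601 = 2 + 599: the mean is at most twice the share, and the exponent −597·share is far below −2
  -- ln k.
  refine card_pinnedEquivs_tail_le (θ := 1) (κ := 2 * M.share) (lam := 599 * M.share) ?_ hy0 hy1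
    zero_le_one le_rfl hμ (by linarith) ?_
  · simp
  · linarith [M.share_bounds.1, M.four_le_log]

/-- The load of the times before `t` has a subgaussian upper tail. -/
theorem card_prefix_overfull_le (ht : t ∈ M.ro) (i : Fin M.ro.card)
    (h8 : 8 * M.ℓ * (M.Γ + 2) ≤ M.n) (hy0 : ∀ j, 0 ≤ y j) (hy1 : ∀ j, y j ≤ 1)
    (hY : ∑ j, y j ≤ M.k + 1) {c δ : ℝ} (hδ0 : 0 ≤ δ) (hδ1 : δ ≤ 1)
    (hc : M.k * (t / M.n) + M.Γ * M.share + 2 + M.k * δ ≤ c) :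
    (({σ ∈ pinnedEquivs (⟨t, ht⟩ : M.ro) i | c ≤
      ∑ s ∈ Finset.Ico 1 t, M.itemLoad y σ s} : Finset _).card : ℝ) ≤
      Real.exp (-(M.k * δ ^ 2 / 8)) * (pinnedEquivs (⟨t, ht⟩ : M.ro) i).card := by
  simp_rw [sum_itemLoad]
  have hn := M.n_pos
  have hm := M.card_ro_sub_one_ge h8
  have hm0 : (0 : ℝ) < M.ro.card - 1 := by linarith
  have ht' := Finset.mem_sdiff.1 ht
  have htn := Finset.mem_Icc.1 ht'.1
  have hYn : 0 ≤ ∑ j, y j := Finset.sum_nonneg fun j _ => hy0 j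
  set N : ℕ := ((Finset.Ico 1 t).subtype (· ∈ M.ro)).card with hN
  -- Adversarial times after t raise the fraction of random-order times before t; there are at most
  -- Γℓ of them.
  have hrest : (M.n : ℝ) - t - M.Γ * M.ℓ ≤ M.ro.card - 1 - N := by
    have hsplit : M.ro.card = N + 1 + (Finset.Ioc t M.n \ M.adv).card := by
      rw [hN, Finset.card_subtype]
      have e : M.ro = (insert t ({s ∈ Finset.Ico 1 t | s ∈ M.ro})) ∪ (Finset.Ioc t M.n \ M.adv) := by
        ext s
        simp only [Finset.mem_sdiff, Finset.mem_Icc, Finset.mem_union, Finset.mem_insert,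
          Finset.mem_filter, Finset.mem_Ico, Finset.mem_Ioc]
        constructor
        · rintro ⟨h1, h2⟩
          rcases lt_trichotomy s t with h | h | h
          · exact Or.inl (Or.inr ⟨⟨h1.1, h⟩, h1, h2⟩)
          · exact Or.inl (Or.inl h)
          · exact Or.inr ⟨⟨h, h1.2⟩, h2⟩
        · rintro ((rfl | h) | h)
          · exact ⟨htn, ht'.2⟩
          · exact h.2
          · exact ⟨⟨by omega, h.1.2⟩, h.2⟩
      conv_lhs => rw [e]
      rw [Finset.card_union_of_disjoint, Finset.card_insert_of_notMem (by simp)]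
      rw [Finset.disjoint_left]
      intro s hs hs'
      simp only [Finset.mem_insert, Finset.mem_filter, Finset.mem_Ico, Finset.mem_sdiff,
        Finset.mem_Ioc] at hs hs'
      omega
    have h1 := Finset.le_card_sdiff M.adv (Finset.Ioc t M.n)
    have h2 := (Finset.card_le_card M.adv_subset_advUnion).trans M.card_advUnion_le
    rw [Nat.card_Ioc] at h1
    have h3 : M.n + N + 1 ≤ M.ro.card + t + M.Γ * M.ℓ := by omega
    have : (M.n : ℝ) + N + 1 ≤ M.ro.card + t + M.Γ * M.ℓ := by exact_mod_cast h3
    linarith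
  have hN1 : (N : ℝ) ≤ M.ro.card - 1 := by
    have := Finset.card_lt_univ_of_notMem
      (s := (Finset.Ico 1 t).subtype (· ∈ M.ro)) (x := ⟨t, ht⟩) (by simp)
    rw [Fintype.card_coe] at this
    have : ((N + 1 : ℕ) : ℝ) ≤ M.ro.card := by exact_mod_cast this
    push_cast at this; linarith
  have hp1 : (N : ℝ) / (M.ro.card - 1) ≤ 1 := (div_le_one hm0).2 hN1
  have hp0 : 0 ≤ (N : ℝ) / (M.ro.card - 1) := by positivity
  have hp2 : (N : ℝ) / (M.ro.card - 1) ≤ t / M.n + M.Γ * (M.ℓ / M.n) := by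
    have h1 : ((M.ro.card : ℝ) - 1 - N) / M.n ≤ (M.ro.card - 1 - N) / (M.ro.card - 1) :=
      div_le_div_of_nonneg_left (by linarith) hm0 (by linarith [M.card_ro_le])
    have h2 : ((M.n : ℝ) - t - M.Γ * M.ℓ) / M.n ≤ ((M.ro.card : ℝ) - 1 - N) / M.n :=
      div_le_div_of_nonneg_right hrest hn.le
    have h3 : ((M.n : ℝ) - t - M.Γ * M.ℓ) / M.n = 1 - (t / M.n + M.Γ * (M.ℓ / M.n)) := by
      field_simp; ring
    have h4 : ((M.ro.card : ℝ) - 1 - N) / (M.ro.card - 1) = 1 - N / (M.ro.card - 1) := by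
      rw [sub_div, div_self hm0.ne']
    linarith
  have hk := M.k_ge
  have hμ1 : (N : ℝ) / (M.ro.card - 1) * ∑ j, y j ≤ M.k + 1 :=
    (mul_le_of_le_one_left hYn hp1).trans hY
  have hμ2 : (N : ℝ) / (M.ro.card - 1) * ∑ j, y j ≤ M.k * (t / M.n) + M.Γ * M.share + 2 := by
    have h1 : (N : ℝ) / (M.ro.card - 1) * ∑ j, y j ≤ (N : ℝ) / (M.ro.card - 1) * (M.k + 1) :=
      mul_le_mul_of_nonneg_left hY hp0
    have h2 := mul_le_mul_of_nonneg_left hp2 (show 0 ≤ M.k by linarith)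
    have h3 : M.k * (t / M.n + M.Γ * (M.ℓ / M.n)) = M.k * (t / M.n) + M.Γ * M.share := by
      rw [share]; ring
    nlinarith
  have hFc : ((Fintype.card M.ro : ℕ) : ℝ) = M.ro.card := by rw [Fintype.card_coe]
  -- The exponent is δ²(k + 1)/4 − kδ²/2, at most −kδ²/8.
  refine card_pinnedEquivs_tail_le (θ := δ / 2) (κ := M.k + 1) (lam := M.k * δ) ?_ hy0 hy1
    (by linarith) (by linarith) (by rw [hFc]; exact hμ1) (by rw [hFc]; linarith) ?_
  · simp
  · nlinarith [sq_nonneg δ]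

/-- It is unlikely that the free times up to the end of a window receive too small a load. -/
theorem card_free_underfull_le (ht : t ∈ M.ro) (i : Fin M.ro.card)
    (h8 : 8 * M.ℓ * (M.Γ + 2) ≤ M.n) (hy0 : ∀ j, 0 ≤ y j) (hy1 : ∀ j, y j ≤ 1)
    (hY : ∑ j, y j ≤ M.k + 1) (hY' : M.k ≤ ∑ j, y j) {b : ℕ} (hb : b * M.ℓ < t)
    (hbΓ : 4 * M.Γ ≤ b + 1) :
    (({σ ∈ pinnedEquivs (⟨t, ht⟩ : M.ro) i |
      ∑ s ∈ Finset.Icc 1 (b * M.ℓ) \ M.advUnion, M.itemLoad y σ s ≤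
        (b + 1 - 4 * M.Γ) * M.share} : Finset _).card : ℝ) ≤
      Real.exp (-(2 * Real.log M.k)) * (pinnedEquivs (⟨t, ht⟩ : M.ro) i).card := by
  classical
  simp_rw [sum_itemLoad]
  have hn := M.n_pos
  have hm := M.card_ro_sub_one_ge h8
  have hm0 : (0 : ℝ) < M.ro.card - 1 := by linarith
  have htn := Finset.mem_Icc.1 (Finset.mem_sdiff.1 ht).1
  have hYn : 0 ≤ ∑ j, y j := Finset.sum_nonneg fun j _ => hy0 j
  set a : M.ro := ⟨t, ht⟩ with ha
  set T : Finset M.ro := (Finset.Icc 1 (b * M.ℓ) \ M.advUnion).subtype (· ∈ M.ro) with hT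
  have haT : a ∉ T := by
    simp only [hT, ha, Finset.mem_subtype, Finset.mem_sdiff, Finset.mem_Icc]
    omega
  have hTcard : ((b : ℝ) - M.Γ) * M.ℓ ≤ T.card := by
    have e : T.card = (Finset.Icc 1 (b * M.ℓ) \ M.advUnion).card := by
      rw [hT, Finset.card_subtype, Finset.filter_true_of_mem]
      intro s hs
      simp only [Finset.mem_sdiff, Finset.mem_Icc] at hs ⊢
      exact ⟨⟨hs.1.1, by omega⟩, fun h => hs.2 (M.adv_subset_advUnion h)⟩
    have h1 := Finset.le_card_sdiff M.advUnion (Finset.Icc 1 (b * M.ℓ))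
    have h2 := M.card_advUnion_le
    rw [Nat.card_Icc] at h1
    have h3 : b * M.ℓ ≤ T.card + M.Γ * M.ℓ := by omega
    have : (b : ℝ) * M.ℓ ≤ T.card + M.Γ * M.ℓ := by exact_mod_cast h3
    linarith
  -- The lower tail on T becomes an upper tail on the complementary positions R, because the total
  -- weight is fixed.
  set R : Finset M.ro := (Finset.univ \ T).erase a with hR
  have hRcard : (R.card : ℝ) = M.ro.card - 1 - T.card := by
    rw [hR, Finset.cast_card_erase_of_mem (by simp [haT]),
      Finset.cast_card_sdiff (Finset.subset_univ _), Finset.card_univ, Fintype.card_coe]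
    ring
  have hsumR : ∀ σ ∈ pinnedEquivs a i,
      ∑ u ∈ R, y (σ u) = ∑ j, y j - y i - ∑ u ∈ T, y (σ u) := by
    intro σ hσ
    have hσi : σ a = i := by simpa [pinnedEquivs] using hσ
    have h1 : ∑ u ∈ R, y (σ u) + y (σ a) = ∑ u ∈ Finset.univ \ T, y (σ u) :=
      Finset.sum_erase_add _ _ (by simp [haT])
    have h2 := Finset.sum_sdiff (f := fun u => y (σ u)) (Finset.subset_univ T)
    rw [Equiv.sum_comp σ y] at h2
    rw [hσi] at h1
    linarith
  have hR0 : (0 : ℝ) ≤ R.card := Nat.cast_nonneg _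
  have hp1 : (R.card : ℝ) / (M.ro.card - 1) ≤ 1 :=
    (div_le_one hm0).2 (by rw [hRcard]; linarith [(Nat.cast_nonneg T.card : (0 : ℝ) ≤ T.card)])
  have hp2 : (R.card : ℝ) / (M.ro.card - 1) ≤ 1 - (b - M.Γ) * (M.ℓ / M.n) := by
    have h1 : (T.card : ℝ) / M.n ≤ T.card / (M.ro.card - 1) :=
      div_le_div_of_nonneg_left (Nat.cast_nonneg _) hm0 (by linarith [M.card_ro_le])
    have h2 : ((b : ℝ) - M.Γ) * M.ℓ / M.n ≤ T.card / M.n :=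
      div_le_div_of_nonneg_right hTcard hn.le
    rw [hRcard, sub_div, div_self hm0.ne']
    rw [mul_div_assoc] at h2
    linarith
  have hbΓ' : (4 * M.Γ : ℝ) ≤ b + 1 := by exact_mod_cast hbΓ
  have hΓ := M.Γ_ge_eight
  have hk := M.k_ge
  have hq := M.share_ge
  have hμ1 : (R.card : ℝ) / (M.ro.card - 1) * ∑ j, y j ≤ M.k + 1 :=
    (mul_le_of_le_one_left hYn hp1).trans hY
  have hμ2 : (R.card : ℝ) / (M.ro.card - 1) * ∑ j, y j ≤ ∑ j, y j - (b - M.Γ) * M.share := by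
    refine (mul_le_mul_of_nonneg_right hp2 hYn).trans ?_
    have h1 : (0 : ℝ) ≤ (b - M.Γ) * (M.ℓ / M.n) := mul_nonneg (by linarith) (by positivity)
    have h2 := mul_le_mul_of_nonneg_left hY' h1
    rw [share]
    nlinarith
  have hFc : ((Fintype.card M.ro : ℕ) : ℝ) = M.ro.card := by rw [Fintype.card_coe]
  have hs := M.sqrt_ge
  have hL := M.four_le_log
  -- The gap `lam` is (b − Γ) − (b + 1 − 4Γ) = 3Γ − 1 shares, less 1 for the pinned item i.
  have hmain := card_pinnedEquivs_tail_le (a := a) (i := i) (T := R) (y := y)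
    (θ := Real.log M.k / Real.sqrt M.k) (κ := M.k + 1) (lam := (3 * M.Γ - 1) * M.share - 1)
    (c := ∑ j, y j - 1 - (b + 1 - 4 * M.Γ) * M.share) (d := -(2 * Real.log M.k)) (by simp [hR])
    hy0 hy1 (by positivity) ((div_le_one (by linarith)).2 M.log_le_sqrt)
    (by rw [hFc]; exact hμ1) (by rw [hFc]; linarith) M.underfull_exponent_le
  refine le_trans ?_ hmain
  exact_mod_cast Finset.card_le_card fun σ hσ => by
    rw [Finset.mem_filter] at hσ ⊢
    refine ⟨hσ.1, ?_⟩
    rw [hsumR σ hσ.1]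
    linarith [hσ.2, hy1 i]
end Tails

end BaroInstance

/-! ### The deterministic part -/

namespace BaroInstance

/-- The weights that keep only the items of `D`. -/
noncomputable def denseWeight (M : BaroInstance)
    (D : Finset (Fin M.ro.card)) (j : Fin M.ro.card) : ℝ := if j ∈ D then M.w j else 0

theorem denseWeight_nonneg (M : BaroInstance) (D : Finset (Fin M.ro.card))
    (j : Fin M.ro.card) : 0 ≤ M.denseWeight D j := by
  rw [denseWeight]; split_ifs
  · exact (M.w_pos j).le
  · exact le_rfl

theorem denseWeight_le_one (M : BaroInstance) (D : Finset (Fin M.ro.card))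
    (j : Fin M.ro.card) : M.denseWeight D j ≤ 1 := by
  rw [denseWeight]; split_ifs
  · exact M.w_le_one j
  · exact zero_le_one

theorem sum_denseWeight (M : BaroInstance) (D : Finset (Fin M.ro.card)) :
    ∑ j, M.denseWeight D j = ∑ j ∈ D, M.w j := by
  simp [denseWeight, Finset.sum_ite_mem]

/-- The realised orders for which the dense items `D` are spread over the times before `t` as
evenly as they should be. -/
structure Typical (M : BaroInstance) (D : Finset (Fin M.ro.card)) (t : ℕ)
    (σ : M.ro ≃ Fin M.ro.card) : Prop where
  free_load : D ≠ Finset.univ → ∀ b : ℕ, b * M.ℓ < t → 4 * M.Γ ≤ b + 1 →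
    (b + 1 - 4 * M.Γ) * M.share <
      ∑ s ∈ Finset.Icc 1 (b * M.ℓ) \ M.advUnion, M.itemLoad (M.denseWeight D) σ s
  window_load : ∀ b : ℕ, b * M.ℓ < t →
    ∑ s ∈ baroWindow M.ℓ b ∩ Finset.Ico 1 t, M.itemLoad (M.denseWeight D) σ s < 601 * M.share

end BaroInstance

namespace BaroRun

variable {M : BaroInstance} {Ω : Type*} [MeasurableSpace Ω] {P : MeasureTheory.Measure Ω}

theorem V_div_W (S : BaroRun M P) (ω : Ω) {s : ℕ} (hs : s ∈ M.ro) :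
    S.V ω s / S.W ω s = M.v (S.I ω ⟨s, hs⟩) / M.w (S.I ω ⟨s, hs⟩) := by
  rw [S.V_ro ω ⟨s, hs⟩, S.W_ro ω ⟨s, hs⟩]

/-- After time 4Γℓ the budget is nonnegative; feasibility is what makes the algorithm's solution
optimal. -/
theorem lpFeasible_zero {W : ℕ → ℝ} {s : ℕ} (hs : 4 * M.Γ * M.ℓ < s) :
    M.LPFeasible W s 0 := by
  have hs' : (4 * M.Γ * M.ℓ : ℝ) < s := by exact_mod_cast hs
  have hs0 : (0 : ℝ) < s := lt_of_le_of_lt (by positivity) hs'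
  have hk : 0 < M.k := by linarith [M.k_ge]
  have hsc : 0 ≤ M.scale s := by
    rw [BaroInstance.scale, sub_nonneg]
    exact (div_le_one hs0).2 hs'.le
  refine ⟨?_, fun b => ?_, fun r _ => ?_⟩
  · simp only [Pi.zero_apply, mul_zero, Finset.sum_const_zero]; positivity
  · simp only [Pi.zero_apply, mul_zero, Finset.sum_const_zero]; positivity
  · simp

/-- In a typical order, only dense items are tentatively picked at free times. -/
theorem dense_of_picked (S : BaroRun M P) {ω : Ω} {D : Finset (Fin M.ro.card)} {t s : ℕ}
    (hD : ∀ i ∈ D, ∀ j ∉ D, M.v j / M.w j < M.v i / M.w i)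
    (hT : M.Typical D t (S.I ω)) (hs : M.IsFree s) (hst : s < t) (hsΓ : 4 * M.Γ * M.ℓ < s)
    (hX : 0 < S.X ω s s) : S.I ω ⟨s, hs.mem_ro⟩ ∈ D := by
  classical
  by_contra hsD
  have hsI := Finset.mem_Icc.1 hs.1
  have hℓ := M.ℓ_pos
  have hn := M.n_pos
  have hopt := S.X_optimal ω s hs.1 ⟨0, lpFeasible_zero hsΓ⟩
  set f := M.itemLoad (M.denseWeight D) (S.I ω) with hf
  have hf0 : ∀ r, 0 ≤ f r := M.itemLoad_nonneg (M.denseWeight_nonneg D) _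
  -- Since sizes are positive, these are exactly the free times up to s that carry an item of D.
  set F : Finset ℕ := {r ∈ Finset.Icc 1 s \ M.advUnion | 0 < f r} with hFdef
  have hfree : ∀ r ∈ Finset.Icc 1 s \ M.advUnion, M.IsFree r := by
    intro r hr
    simp only [Finset.mem_sdiff, Finset.mem_Icc] at hr
    exact M.isFree_iff.2 ⟨Finset.mem_Icc.2 ⟨hr.1.1, hr.1.2.trans hsI.2⟩, hr.2⟩
  have hf_eq : ∀ {r} (hr : M.IsFree r),
      f r = if S.I ω ⟨r, hr.mem_ro⟩ ∈ D then S.W ω r else 0 := by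
    intro r hr
    rw [hf, BaroInstance.itemLoad, dif_pos hr.mem_ro, BaroInstance.denseWeight,
      S.W_ro ω ⟨r, hr.mem_ro⟩]
  have hWpos : ∀ {r} (_ : M.IsFree r), 0 < S.W ω r := by
    intro r hr
    rw [S.W_ro ω ⟨r, hr.mem_ro⟩]; exact M.w_pos _
  have hmemF : ∀ {r} (hr : M.IsFree r), r ≤ s → (r ∈ F ↔ S.I ω ⟨r, hr.mem_ro⟩ ∈ D) := by
    intro r hr hrs
    rw [hFdef, Finset.mem_filter, hf_eq hr]
    have h1 : r ∈ Finset.Icc 1 s \ M.advUnion := Finset.mem_sdiff.2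
      ⟨Finset.mem_Icc.2 ⟨(Finset.mem_Icc.1 hr.1).1, hrs⟩, (M.isFree_iff.1 hr).2⟩
    by_cases hd : S.I ω ⟨r, hr.mem_ro⟩ ∈ D
    · simp only [h1, hd, if_true, hWpos hr, true_and]
    · simp only [hd, if_false, lt_irrefl, and_false]
  have hFfree : ∀ r ∈ F, M.IsFree r ∧ r ≤ s := by
    intro r hr
    have := (Finset.mem_filter.1 hr).1
    exact ⟨hfree r this, (Finset.mem_Icc.1 (Finset.mem_sdiff.1 this).1).2⟩
  have hFD : ∀ r (hr : r ∈ F), S.I ω ⟨r, (hFfree r hr).1.mem_ro⟩ ∈ D := fun r hr =>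
    (hmemF (hFfree r hr).1 (hFfree r hr).2).1 hr
  have hFf : ∀ r ∈ F, S.W ω r = f r := fun r hr => by
    rw [hf_eq (hFfree r hr).1, if_pos (hFD r hr)]
  have hDuniv : D ≠ Finset.univ := fun h => hsD (h ▸ Finset.mem_univ _)
  refine absurd hX (not_lt.2 (hopt.nonpos_of_dense hℓ hsI.1 (hWpos hs)
    (fun u hu => ?_) (F := F) ?_ ?_ ?_ ?_ ?_ ?_ ?_))
  · have hu := Finset.mem_Icc.1 hu
    exact (S.W_mem ω u (Finset.mem_Icc.2 ⟨hu.1, hu.2.trans hsI.2⟩)).1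
  · exact (Finset.filter_subset _ _).trans Finset.sdiff_subset
  · exact fun h => hsD ((hmemF hs le_rfl).1 h)
  · exact fun u hu => hWpos (hFfree u hu).1
  · intro u hu
    rw [S.V_div_W ω hs.mem_ro, S.V_div_W ω (hFfree u hu).1.mem_ro]
    exact hD _ (hFD u hu) _ hsD
  -- The load is compared at bℓ < s, the budget at (b + 1)ℓ ≥ s. Losing one window this way lets the
  -- union bound run over windows instead of times.
  · set b := (s - 1) / M.ℓ with hb
    have hb1 : b * M.ℓ ≤ s - 1 := Nat.div_mul_le_self _ _
    have hb2 : s ≤ (b + 1) * M.ℓ := by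
      have := Nat.lt_div_mul_add (a := s - 1) hℓ
      rw [← hb] at this
      rw [add_mul, one_mul]; omega
    have hbΓ : 4 * M.Γ ≤ b + 1 :=
      (Nat.lt_of_mul_lt_mul_right (hsΓ.trans_le hb2)).le
    have h1 := hT.free_load hDuniv b (by omega) hbΓ
    have h2 : ∑ r ∈ Finset.Icc 1 (b * M.ℓ) \ M.advUnion, f r ≤ ∑ u ∈ F, S.W ω u := by
      rw [Finset.sum_congr rfl hFf, hFdef, Finset.sum_filter_of_ne fun r _ hr =>
        lt_of_le_of_ne (hf0 r) (Ne.symm hr)]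
      exact Finset.sum_le_sum_of_subset_of_nonneg
        (Finset.sdiff_subset_sdiff (Finset.Icc_subset_Icc_right (by omega)) le_rfl)
        fun r _ _ => hf0 r
    have h3 : M.scale s * (s / M.n) * M.k ≤ (b + 1 - 4 * M.Γ) * M.share := by
      have hs0 : (0 : ℝ) < s := by exact_mod_cast hsI.1
      have e : M.scale s * (s / M.n) * M.k = (s - 4 * M.Γ * M.ℓ) * (M.k / M.n) := by
        rw [BaroInstance.scale]; field_simp
      have e' : (b + 1 - 4 * M.Γ) * M.share = ((b + 1) * M.ℓ - 4 * M.Γ * M.ℓ) * (M.k / M.n) := by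
        rw [BaroInstance.share]; ring
      have hb2' : (s : ℝ) ≤ (b + 1) * M.ℓ := by exact_mod_cast hb2
      rw [e, e']
      exact mul_le_mul_of_nonneg_right (by linarith)
        (div_nonneg (by linarith [M.k_ge]) hn.le)
    linarith
  · intro u hu b hub
    have hbt : b * M.ℓ < t := by
      have h1 := (Finset.mem_Icc.1 hub).1
      have h2 := (hFfree u hu).2
      omega
    have h1 := hT.window_load b hbt
    have h2 : ∑ r ∈ F ∩ baroWindow M.ℓ b, S.W ω r ≤
        ∑ r ∈ baroWindow M.ℓ b ∩ Finset.Ico 1 t, f r := by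
      rw [Finset.sum_congr rfl fun r hr => hFf r (Finset.mem_inter.1 hr).1]
      refine Finset.sum_le_sum_of_subset_of_nonneg (fun r hr => ?_) fun r _ _ => hf0 r
      rw [Finset.mem_inter] at hr ⊢
      have := hFfree r hr.1
      exact ⟨hr.2, Finset.mem_Ico.2 ⟨(Finset.mem_Icc.1 this.1.1).1, by omega⟩⟩
    rw [mul_assoc]
    exact h2.trans_lt h1
  -- The window of a free time is entirely free, so r carries a random-order item outside D.
  · intro u hu b hub r hr hrF
    rw [Finset.mem_inter] at hr
    have hrI := Finset.mem_Icc.1 hr.2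
    have hu1 : 1 ≤ u := (Finset.mem_Icc.1 (hFfree u hu).1.1).1
    have hrfree : M.IsFree r := by
      refine ⟨Finset.mem_Icc.2 ⟨hrI.1, hrI.2.trans hsI.2⟩, fun b' hb' hrb' => ?_⟩
      have e : b' = b := ((mem_baroWindow_iff hrI.1 hℓ).1 hrb').trans
        ((mem_baroWindow_iff hrI.1 hℓ).1 hr.1).symm
      exact (hFfree u hu).1.2 b' hb' (e ▸ hub)
    refine ⟨hWpos hrfree, ?_⟩
    rw [S.V_div_W ω hrfree.mem_ro, S.V_div_W ω (hFfree u hu).1.mem_ro]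
    exact hD _ (hFD u hu) _ fun h => hrF ((hmemF hrfree hrI.2).2 h)

/-- In a typical order with a moderate total load of dense items, the algorithm is not blocked. -/
theorem unblocked_of_typical (S : BaroRun M P) {ω : Ω} {D : Finset (Fin M.ro.card)} {t : ℕ}
    {a₄ : ℝ} (ha₄ : 700 ≤ a₄)
    (hD : ∀ i ∈ D, ∀ j ∉ D, M.v j / M.w j < M.v i / M.w i)
    (hT : M.Typical D t (S.I ω)) (ht : M.IsFree t) (h8 : 8 * M.ℓ * (M.Γ + 2) ≤ t)
    (hload : ∑ s ∈ Finset.Ico 1 t, M.itemLoad (M.denseWeight D) (S.I ω) s <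
      M.k - 1 - 5 * M.Γ * (a₄ * M.share)) :
    M.Unblocked a₄ (S.W ω) (M.xalg a₄ (S.W ω) (S.X ω)) t := by
  classical
  have hℓ := M.ℓ_pos
  have hq := M.share_ge
  have htI := Finset.mem_Icc.1 ht.1
  set f := M.itemLoad (M.denseWeight D) (S.I ω) with hf
  have hf0 : ∀ r, 0 ≤ f r := M.itemLoad_nonneg (M.denseWeight_nonneg D) _
  set x := M.xalg a₄ (S.W ω) (S.X ω) with hx
  have haq : a₄ * (M.ℓ / M.n) * M.k = a₄ * M.share := by rw [BaroInstance.share]; ring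
  have hx0 : ∀ s ∈ Finset.Ico 1 t, 0 ≤ S.W ω s * x s := fun s hs => by
    have hs := Finset.mem_Ico.1 hs
    exact mul_nonneg (S.W_mem ω s (Finset.mem_Icc.2 ⟨hs.1, by omega⟩)).1
      (M.xalg_nonneg _ _ _ hs.1)
  have hdom : ∀ s, M.IsFree s → s < t → 4 * M.Γ * M.ℓ < s → S.W ω s * x s ≤ f s := by
    intro s hs hst hsΓ
    have hs1 := (Finset.mem_Icc.1 hs.1).1
    rw [hx, M.xalg_eq _ _ _ hs1]
    split_ifs with h
    · have hd := S.dense_of_picked hD hT hs hst hsΓ h.1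
      rw [hf, BaroInstance.itemLoad, dif_pos hs.mem_ro, BaroInstance.denseWeight, if_pos hd,
        mul_one, S.W_ro ω ⟨s, hs.mem_ro⟩]
    · rw [mul_zero]; exact hf0 s
  rw [BaroInstance.Unblocked, haq]
  constructor
  · rw [baroLast_eq htI.1 hℓ]
    set b := (t - 1) / M.ℓ with hb
    have htb : t ∈ baroWindow M.ℓ b := (mem_baroWindow_iff htI.1 hℓ).2 rfl
    have htb' := Finset.mem_Icc.1 htb
    have h1 := hT.window_load b (by omega)
    have h2 : ∑ s ∈ baroWindow M.ℓ b ∩ Finset.Ico 1 t, S.W ω s * x s ≤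
        ∑ s ∈ baroWindow M.ℓ b ∩ Finset.Ico 1 t, f s := by
      refine Finset.sum_le_sum fun s hs => ?_
      rw [Finset.mem_inter] at hs
      have hsI := Finset.mem_Ico.1 hs.2
      refine hdom s ⟨Finset.mem_Icc.2 ⟨hsI.1, by omega⟩, fun b' hb' hsb' => ?_⟩ hsI.2 ?_
      · have e : b' = b := ((mem_baroWindow_iff hsI.1 hℓ).1 hsb').trans
          ((mem_baroWindow_iff hsI.1 hℓ).1 hs.1).symm
        exact ht.2 b' hb' (e ▸ htb)
      · have h3 := (Finset.mem_Icc.1 hs.1).1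
        have h4 := htb'.2
        rw [add_mul, one_mul] at h4
        nlinarith
    nlinarith
  -- The windows without control by D: those where the LP may be infeasible, and the adversarial
  -- ones.
  · set H : Finset ℕ := Finset.range (4 * M.Γ) ∪ M.advWindows with hH
    have hHcard : (H.card : ℝ) ≤ 5 * M.Γ := by
      have h1 := Finset.card_union_le (Finset.range (4 * M.Γ)) M.advWindows
      have h2 := M.advWindows_card
      rw [Finset.card_range, ← hH] at h1
      have h3 : H.card ≤ 5 * M.Γ := by omega
      exact_mod_cast h3
    set U : Finset ℕ := H.biUnion fun b => baroWindow M.ℓ b ∩ Finset.Ico 1 t with hU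
    have hUsub : U ⊆ Finset.Ico 1 t := Finset.biUnion_subset.2 fun b _ => Finset.inter_subset_right
    have h1 : ∑ s ∈ U, S.W ω s * x s ≤ 5 * M.Γ * (a₄ * M.share) := by
      have hb : ∀ b ∈ H, ∑ s ∈ baroWindow M.ℓ b ∩ Finset.Ico 1 t, S.W ω s * x s ≤
          a₄ * M.share := by
        intro b _
        have := M.sum_window_xalg_le (a₄ := a₄) (W := S.W ω) (S.X ω) hℓ
          (by rw [haq]; nlinarith) (S.W_mem ω) b (t := t - 1) (by omega)
        rwa [Nat.sub_add_cancel htI.1, haq] at this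
      have hsum : ∑ s ∈ U, S.W ω s * x s =
          ∑ b ∈ H, ∑ s ∈ baroWindow M.ℓ b ∩ Finset.Ico 1 t, S.W ω s * x s := by
        refine Finset.sum_biUnion fun b _ b' _ hne => Finset.disjoint_left.2 fun s hs hs' => hne ?_
        rw [Finset.mem_inter] at hs hs'
        have hs1 := (Finset.mem_Ico.1 hs.2).1
        exact ((mem_baroWindow_iff hs1 hℓ).1 hs.1).trans ((mem_baroWindow_iff hs1 hℓ).1 hs'.1).symm
      rw [hsum]
      refine (Finset.sum_le_card_nsmul _ _ _ hb).trans ?_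
      rw [nsmul_eq_mul]
      exact mul_le_mul_of_nonneg_right hHcard (by nlinarith)
    have h2 : ∑ s ∈ Finset.Ico 1 t \ U, S.W ω s * x s ≤ ∑ s ∈ Finset.Ico 1 t, f s := by
      refine le_trans (Finset.sum_le_sum fun s hs => ?_)
        (Finset.sum_le_sum_of_subset_of_nonneg Finset.sdiff_subset fun s _ _ => hf0 s)
      obtain ⟨hs1, hsU⟩ := Finset.mem_sdiff.1 hs
      have hsI := Finset.mem_Ico.1 hs1
      have hnot : ∀ b ∈ H, s ∉ baroWindow M.ℓ b := fun b hb hsb =>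
        hsU (Finset.mem_biUnion.2 ⟨b, hb, Finset.mem_inter.2 ⟨hsb, hs1⟩⟩)
      refine hdom s ⟨Finset.mem_Icc.2 ⟨hsI.1, by omega⟩, fun b hb =>
        hnot b (Finset.mem_union_right _ hb)⟩ hsI.2 ?_
      by_contra! hle
      refine hnot ((s - 1) / M.ℓ) (Finset.mem_union_left _ (Finset.mem_range.2 ?_))
        ((mem_baroWindow_iff hsI.1 hℓ).2 rfl)
      rw [Nat.div_lt_iff_lt_mul hℓ]
      omega
    rw [← Finset.sum_sdiff hUsub]
    linarith

/-! ### Probabilities -/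

/-- Conditional probabilities in a run are bounded by counting orders. -/
theorem cond_real_le (S : BaroRun M P) [MeasureTheory.IsProbabilityMeasure P] (a : M.ro)
    (i : Fin M.ro.card) {E : Set Ω} {B : Finset (M.ro ≃ Fin M.ro.card)}
    (hE : ∀ ω ∈ E, S.I ω a = i → S.I ω ∈ B) {ε : ℝ} (hε : 0 ≤ ε)
    (hB : (B.card : ℝ) ≤ ε * (pinnedEquivs a i).card) :
    (ProbabilityTheory.cond P {ω | S.I ω a = i}).real E ≤ ε := by
  classical
  have hpre : ∀ A : Finset (M.ro ≃ Fin M.ro.card),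
      MeasurableSet {ω | S.I ω ∈ A} ∧
        P.real {ω | S.I ω ∈ A} = A.card * (1 / (M.ro.card.factorial : ℝ)) := by
    intro A
    have e : {ω | S.I ω ∈ A} = ⋃ σ ∈ A, {ω | S.I ω = σ} := by ext ω; simp
    rw [e]
    refine ⟨Finset.measurableSet_biUnion _ fun σ _ => S.I_measurable σ, ?_⟩
    rw [MeasureTheory.measureReal_biUnion_finset, Finset.sum_congr rfl fun σ _ => S.I_uniform σ,
      Finset.sum_const, nsmul_eq_mul]
    · intro σ _ τ _ hne
      exact Set.disjoint_left.2 fun ω h1 h2 => hne (h1.symm.trans h2)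
    · exact fun σ _ => S.I_measurable σ
  have hset : {ω | S.I ω a = i} = {ω | S.I ω ∈ pinnedEquivs a i} := by
    ext ω; simp [pinnedEquivs]
  have hA := hpre (pinnedEquivs a i)
  rw [← hset] at hA
  rw [MeasureTheory.measureReal_def, ProbabilityTheory.cond_apply hA.1, ENNReal.toReal_mul,
    ENNReal.toReal_inv, ← MeasureTheory.measureReal_def, ← MeasureTheory.measureReal_def]
  -- Monotonicity suffices here, so E itself need not be measurable.
  have h1 : P.real ({ω | S.I ω a = i} ∩ E) ≤ ε * P.real {ω | S.I ω a = i} := by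
    calc P.real ({ω | S.I ω a = i} ∩ E) ≤ P.real {ω | S.I ω ∈ B} :=
          MeasureTheory.measureReal_mono fun ω hω => hE ω hω.2 hω.1
      _ = B.card * (1 / (M.ro.card.factorial : ℝ)) := (hpre B).2
      _ ≤ ε * (pinnedEquivs a i).card * (1 / (M.ro.card.factorial : ℝ)) :=
          mul_le_mul_of_nonneg_right hB (by positivity)
      _ = ε * P.real {ω | S.I ω a = i} := by rw [hA.2, mul_assoc]
  rcases (MeasureTheory.measureReal_nonneg (μ := P) (s := {ω | S.I ω a = i})).eq_or_lt with h0 | h0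
  · rw [← h0]; simpa using hε
  · rw [inv_mul_le_iff₀ h0]; linarith

/-- Few orders are atypical. -/
theorem exists_atypical_finset {D : Finset (Fin M.ro.card)} {t : ℕ} (ht : M.IsFree t)
    (i : Fin M.ro.card) (h8 : 8 * M.ℓ * (M.Γ + 2) ≤ M.n) (hD1 : ∑ j ∈ D, M.w j ≤ M.k + 1)
    (hD2 : D = Finset.univ ∨ M.k ≤ ∑ j ∈ D, M.w j) :
    ∃ B : Finset (M.ro ≃ Fin M.ro.card),
      (∀ σ ∈ pinnedEquivs ⟨t, ht.mem_ro⟩ i, σ ∉ B → M.Typical D t σ) ∧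
      (B.card : ℝ) ≤ 2 / M.k * (pinnedEquivs (⟨t, ht.mem_ro⟩ : M.ro) i).card := by
  classical
  have hℓ := M.ℓ_pos
  have htI := Finset.mem_Icc.1 ht.1
  have hk : 0 < M.k := by linarith [M.k_ge]
  have hy0 := M.denseWeight_nonneg D
  have hy1 := M.denseWeight_le_one D
  rw [← M.sum_denseWeight] at hD1 hD2
  set y := M.denseWeight D
  set A := pinnedEquivs (⟨t, ht.mem_ro⟩ : M.ro) i with hA
  -- The side conditions sit inside the filter, so `B₁ b` is empty wherever the underfull bound does
  -- not apply.
  set B₁ : ℕ → Finset (M.ro ≃ Fin M.ro.card) := fun b =>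
    {σ ∈ A | (D ≠ Finset.univ ∧ b * M.ℓ < t ∧ 4 * M.Γ ≤ b + 1) ∧
      ∑ s ∈ Finset.Icc 1 (b * M.ℓ) \ M.advUnion, M.itemLoad y σ s ≤
        (b + 1 - 4 * M.Γ) * M.share} with hB₁
  set B₂ : ℕ → Finset (M.ro ≃ Fin M.ro.card) := fun b =>
    {σ ∈ A | 601 * M.share ≤
      ∑ s ∈ baroWindow M.ℓ b ∩ Finset.Ico 1 t, M.itemLoad y σ s} with hB₂
  have hexp : Real.exp (-(2 * Real.log M.k)) = 1 / M.k ^ 2 := by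
    rw [Real.exp_neg, mul_comm, Real.exp_mul, Real.exp_log hk]
    norm_num
  have hc1 : ∀ b, ((B₁ b).card : ℝ) ≤ 1 / M.k ^ 2 * A.card := by
    intro b
    by_cases hcond : D ≠ Finset.univ ∧ b * M.ℓ < t ∧ 4 * M.Γ ≤ b + 1
    · have := M.card_free_underfull_le ht.mem_ro i h8 hy0 hy1 hD1
        (hD2.resolve_left hcond.1) hcond.2.1 hcond.2.2
      rw [hexp] at this
      simpa only [hB₁, hcond, ne_eq, not_false_eq_true, and_self, true_and] using this
    · have : B₁ b = ∅ := by
        refine Finset.eq_empty_of_forall_notMem fun σ hσ => hcond ?_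
        exact (Finset.mem_filter.1 hσ).2.1
      rw [this]
      simp only [Finset.card_empty, Nat.cast_zero]
      positivity
  have hc2 : ∀ b, ((B₂ b).card : ℝ) ≤ 1 / M.k ^ 2 * A.card := by
    intro b
    rw [← hexp]
    exact M.card_window_overfull_le ht.mem_ro i h8 hy0 hy1 hD1 b
  have hrange : ∀ b, b * M.ℓ < t → b ∈ Finset.range (M.n / M.ℓ + 1) := by
    intro b hb
    rw [Finset.mem_range, Nat.lt_succ_iff, Nat.le_div_iff_mul_le hℓ]
    omega
  refine ⟨(Finset.range (M.n / M.ℓ + 1)).biUnion fun b => B₁ b ∪ B₂ b, ?_, ?_⟩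
  · intro σ hσ hσB
    simp only [Finset.mem_biUnion, Finset.mem_union, not_exists, not_and, not_or] at hσB
    refine ⟨fun hu b hb hbΓ => ?_, fun b hb => ?_⟩
    · by_contra! hcon
      exact (hσB b (hrange b hb)).1 (Finset.mem_filter.2 ⟨hσ, ⟨hu, hb, hbΓ⟩, hcon⟩)
    · by_contra! hcon
      exact (hσB b (hrange b hb)).2 (Finset.mem_filter.2 ⟨hσ, hcon⟩)
  · have h1 : (((Finset.range (M.n / M.ℓ + 1)).biUnion fun b => B₁ b ∪ B₂ b).card : ℝ) ≤
        ∑ b ∈ Finset.range (M.n / M.ℓ + 1), (2 / M.k ^ 2 * A.card : ℝ) := by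
      refine (Nat.cast_le.2 Finset.card_biUnion_le).trans ?_
      rw [Nat.cast_sum]
      refine Finset.sum_le_sum fun b _ => ?_
      have h2 : ((B₁ b ∪ B₂ b).card : ℝ) ≤ (B₁ b).card + (B₂ b).card := by
        exact_mod_cast Finset.card_union_le _ _
      have h3 : (2 / M.k ^ 2 * A.card : ℝ) = 1 / M.k ^ 2 * A.card + 1 / M.k ^ 2 * A.card := by ring
      rw [h3]
      exact h2.trans (add_le_add (hc1 b) (hc2 b))
    refine h1.trans ?_
    rw [Finset.sum_const, Finset.card_range, nsmul_eq_mul]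
    have h4 : (2 / M.k * A.card : ℝ) = M.k * (2 / M.k ^ 2 * A.card) := by field_simp
    rw [h4]
    exact mul_le_mul_of_nonneg_right M.window_count_le (by positivity)

end BaroRun

/-! ### Choice of constants and conclusion -/

theorem mainTheorem3 :
    ∃ A₄ : ℝ, 0 < A₄ ∧ ∀ a₄ : ℝ, A₄ ≤ a₄ → ∃ a₅ C : ℝ, 0 < a₅ ∧ 0 < C ∧
      ∀ (M : BaroInstance) {Ω : Type*} [MeasurableSpace Ω] (P : MeasureTheory.Measure Ω)
        [MeasureTheory.IsProbabilityMeasure P] (S : BaroRun M P)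
        (t : ℕ) (ht : M.IsFree t),
        8 * M.ℓ * (M.Γ + 2) ≤ t →
        0 < 1 - (t : ℝ) / M.n - a₅ * (M.Γ * Real.log M.k / M.k) →
        ∀ i : Fin M.ro.card,
          (ProbabilityTheory.cond P {ω | S.I ω ⟨t, ht.mem_ro⟩ = i}).real (S.blocked a₄ t) ≤
            C / (M.k * (1 - (t : ℝ) / M.n - a₅ * (M.Γ * Real.log M.k / M.k)) ^ 2) := by
  classical
  refine ⟨700, by norm_num, fun a₄ ha₄ => ⟨6 * a₄ + 5, 10, by linarith, by norm_num, ?_⟩⟩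
  intro M Ω _ P _ S t ht h8 hδ i
  have hk := M.k_ge
  have hk0 : 0 < M.k := by linarith
  have hn := M.n_pos
  have hL := M.four_le_log
  have hΓ := M.Γ_ge_eight
  have htI := Finset.mem_Icc.1 ht.1
  have h8n : 8 * M.ℓ * (M.Γ + 2) ≤ M.n := h8.trans htI.2
  set δ := 1 - (t : ℝ) / M.n - (6 * a₄ + 5) * (M.Γ * Real.log M.k / M.k) with hδdef
  have hδ1 : δ ≤ 1 := by
    have h1 : 0 ≤ (t : ℝ) / M.n := by positivity
    have h2 : 0 ≤ (6 * a₄ + 5) * (M.Γ * Real.log M.k / M.k) := by positivity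
    linarith
  obtain ⟨D, hD, hD1, hD2⟩ := exists_dense_finset M.density_injective M.w_le_one hk0.le
  obtain ⟨B, hB, hBcard⟩ := BaroRun.exists_atypical_finset ht i h8n hD1 hD2
  -- This determines a₅: the losses are (5a₄ + 1)Γ·share + 3, with share ≤ (9/8) ln k and 3 ≤ Γ ln
  -- k, and (9/8)(5a₄ + 1) + 1 ≤ 6a₄ + 5.
  have hc : M.k * (t / M.n) + M.Γ * M.share + 2 + M.k * δ ≤
      M.k - 1 - 5 * M.Γ * (a₄ * M.share) := by
    have e : M.k * δ = M.k - M.k * (t / M.n) - (6 * a₄ + 5) * (M.Γ * Real.log M.k) := by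
      rw [hδdef]; field_simp
    have h1 : (5 * a₄ + 1) * (M.Γ * M.share) ≤
        (5 * a₄ + 1) * (M.Γ * (9 / 8 * Real.log M.k)) := by
      gcongr
      exact M.share_bounds.2
    have h2 : 3 ≤ M.Γ * Real.log M.k := by nlinarith
    nlinarith
  have hpre := M.card_prefix_overfull_le ht.mem_ro i h8n (M.denseWeight_nonneg D)
    (M.denseWeight_le_one D) ((M.sum_denseWeight D).trans_le hD1) hδ.le hδ1 hc
  set B' : Finset (M.ro ≃ Fin M.ro.card) := {σ ∈ pinnedEquivs (⟨t, ht.mem_ro⟩ : M.ro) i |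
    M.k - 1 - 5 * M.Γ * (a₄ * M.share) ≤
      ∑ s ∈ Finset.Ico 1 t, M.itemLoad (M.denseWeight D) σ s} with hB'
  refine S.cond_real_le _ i (B := B ∪ B') ?_ (by positivity) ?_
  · intro ω hω hi
    by_contra hnot
    rw [Finset.mem_union, not_or] at hnot
    have hmem : S.I ω ∈ pinnedEquivs (⟨t, ht.mem_ro⟩ : M.ro) i := by simpa [pinnedEquivs] using hi
    refine hω (S.unblocked_of_typical ha₄ hD (hB _ hmem hnot.1) ht h8 ?_)
    by_contra! hcon
    exact hnot.2 (Finset.mem_filter.2 ⟨hmem, hcon⟩)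
  · have h1 : ((B ∪ B').card : ℝ) ≤ B.card + B'.card := by exact_mod_cast Finset.card_union_le _ _
    have hx : 0 < M.k * δ ^ 2 := by positivity
    -- The exponential is weakened to e^(−x) ≤ 1/x; with the 2/k from atypical orders and δ ≤ 1 this
    -- gives C = 2 + 8.
    have h2 : Real.exp (-(M.k * δ ^ 2 / 8)) ≤ 8 / (M.k * δ ^ 2) := by
      rw [Real.exp_neg, inv_le_comm₀ (Real.exp_pos _) (by positivity), inv_div]
      linarith [Real.add_one_le_exp (M.k * δ ^ 2 / 8)]
    have h3 : 2 / M.k ≤ 2 / (M.k * δ ^ 2) :=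
      div_le_div_of_nonneg_left zero_le_two hx
        (mul_le_of_le_one_right hk0.le (pow_le_one₀ hδ.le hδ1))
    have h4 : (10 : ℝ) / (M.k * δ ^ 2) = 2 / (M.k * δ ^ 2) + 8 / (M.k * δ ^ 2) := by ring
    rw [h4, add_mul]
    exact h1.trans (add_le_add
      (hBcard.trans (mul_le_mul_of_nonneg_right h3 (Nat.cast_nonneg _)))
      (hpre.trans (mul_le_mul_of_nonneg_right h2 (Nat.cast_nonneg _))))
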